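/- Let $s\ge t\ge 2$ and $r\ge 0$ be integers with $s-t=2r$. Consider correlation experiments in which Alice has the $m_A=s+\binom t2$ two-valued observables $A_1,\dots,A_s$ and $A'_{jj'}$ ($1\le j<j'\le t$), and Bob has the $m_B=t+\binom s2$ two-valued observables $B_1,\dots,B_t$ and $B'_{ii'}$ ($1\le i<i'\le s$). An experimental result is a vector $q\in\mathbb R^{m_A+m_B+m_Am_B}$ with coordinates $q_P$, $q_Q$, $q_{PQ}$, where $P$ runs over Alice's and $Q$ over Bob's observables. A classical configuration assigns values $P,Q\in\{0,1\}$ to all observables and yields $q_P=P$, $q_Q=Q$, $q_{PQ}=P\cdot Q$; the correlation polytope is the convex hull of these vectors. A Bell inequality is a linear inequality $c^{\mathrm T}q\le c_0$ valid on the correlation polytope; it is tight if the set of points of the polytope with $c^{\mathrm T}q=c_0$ is a facet, i.e. a nonempty face whose dimension is one less than that of the polytope. Consider the pure clique-web inequality with parameters $n=s+t+1$, $p=s+1$, $q=t$, $r$, on the complete graph with nodes labelled $A_1,\dots,A_s,X,B_1,\dots,B_t$ in this order: $$\sum_{\substack{1\le k<l\le s+1\\ r+1\le l-k\le s-r}}x_{v_kv_l}+\sum_{1\le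 j<j'\le t}x_{B_jB_{j'}}-\sum_{k=1}^{s+1}\sum_{j=1}^t x_{v_kB_j}\le 0,$$ where $v_k=A_k$ for $k\le s$ and $v_{s+1}=X$. Its triangular elimination is obtained by replacing each term $a\,x_{A_iA_{i'}}$ ($i<i'$) by $a\,x_{A_iB'_{ii'}}-|a|\,x_{A_{i'}B'_{ii'}}$, and each term $a\,x_{B_jB_{j'}}$ ($j<j'$) by $a\,x_{A'_{jj'}B_j}-|a|\,x_{A'_{jj'}B_{j'}}$. Substituting $x_{XP}=q_P$, $x_{XQ}=q_Q$, $x_{PQ}=q_P+q_Q-2q_{PQ}$ in the triangular elimination and dividing by $2$ gives the inequality $$-\sum_{i=r+1}^{s-r}(i-r-1)\,q_{A_i}-t\sum_{i=s-r+1}^{s}q_{A_i}-\sum_{j=1}^t(j+r)\,q_{B_j}+\sum_{i=1}^s\sum_{j=1}^t q_{A_iB_j}$$ $$+\sum_{\substack{1\le i<i'\le s\\ r+1\le i'-i\le s-r}}\bigl(-q_{A_iB'_{ii'}}+q_{A_{i'}B'_{ii'}}\bigr)+\sum_{1\le j<j'\le t}\bigl(-q_{A'_{jj'}B_j}+q_{A'_{jj'}B_{j'}}\bigr)\le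 0,$$ and this inequality is a tight Bell inequality. -/

import Mathlib

/-! ### Correlation experiments, the correlation polytope and tight Bell inequalities -/

/-- Coordinates of an experimental result with Alice's observables indexed by `α` and Bob's by `β`:
one for each `A_i`, one for each `B_j` and one for each pair `(A_i, B_j)`. These are also the edges
`X A_i`, `X B_j`, `A_i B_j` of the complete tripartite graph `K_{1, α, β}`. -/
abbrev BellCoord (α β : Type) : Type := α ⊕ β ⊕ (α × β)

namespace BellCoord

variable {α β : Type}

/-- The coordinate of `A_i` (the edge `X A_i`). -/
abbrev a (i : α) : BellCoord α β := Sum.inl i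

/-- The coordinate of `B_j` (the edge `X B_j`). -/
abbrev b (j : β) : BellCoord α β := Sum.inr (Sum.inl j)

/-- The coordinate of the joint measurement `A_i B_j` (the edge `A_i B_j`). -/
abbrev ab (i : α) (j : β) : BellCoord α β := Sum.inr (Sum.inr (i, j))

end BellCoord

/-- The experimental result of a classical configuration, which assigns the outcome `f i` to `A_i`
and `g j` to `B_j`: `q_{A_i} = f i`, `q_{B_j} = g j`, `q_{A_i B_j} = f i * g j`, with `true` read
as `1` and `false` as `0`. -/
def classicalPoint {α β : Type} (f : α → Bool) (g : β → Bool) : BellCoord α β → ℝ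
  | Sum.inl i => if f i then 1 else 0
  | Sum.inr (Sum.inl j) => if g j then 1 else 0
  | Sum.inr (Sum.inr (i, j)) => if f i && g j then 1 else 0

/-- The correlation polytope: all experimental results that have a local hidden variable model,
i.e. all mixtures of classical configurations. -/
def correlationPolytope (α β : Type) : Set (BellCoord α β → ℝ) :=
  convexHull ℝ (Set.range fun c : (α → Bool) × (β → Bool) => classicalPoint c.1 c.2)

/-- The linear form `cᵀ q`. -/
def linForm {ι : Type} [Fintype ι] (c q : ι → ℝ) : ℝ := ∑ e, c e * q e

/-- The dimension of (the affine hull of) a set. -/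
noncomputable def affineDim {ι : Type} (F : Set (ι → ℝ)) : ℕ :=
  Module.finrank ℝ (vectorSpan ℝ F)

/-- `cᵀ q ≤ c₀` is a Bell inequality: it holds for every experimental result that has a local
hidden variable model. -/
def IsBellInequality {α β : Type} [Fintype α] [Fintype β] (c : BellCoord α β → ℝ) (c₀ : ℝ) :
    Prop :=
  ∀ q ∈ correlationPolytope α β, linForm c q ≤ c₀

/-- The face of the correlation polytope on which `cᵀ q ≤ c₀` holds with equality. -/
def bellFace {α β : Type} [Fintype α] [Fintype β] (c : BellCoord α β → ℝ) (c₀ : ℝ) :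
    Set (BellCoord α β → ℝ) :=
  {q | q ∈ correlationPolytope α β ∧ linForm c q = c₀}

/-- `cᵀ q ≤ c₀` is a tight Bell inequality: it is a Bell inequality, and the face it represents is
a facet of the correlation polytope, i.e. a nonempty face whose dimension is one less than the
dimension of the polytope. -/
def IsTightBellInequality {α β : Type} [Fintype α] [Fintype β] (c : BellCoord α β → ℝ) (c₀ : ℝ) :
    Prop :=
  IsBellInequality c c₀ ∧ (bellFace c c₀).Nonempty ∧
    affineDim (bellFace c c₀) + 1 = affineDim (correlationPolytope α β)

/-- The isomorphism from the correlation polytope to the cut polytope of `K_{1, α, β}`: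
`x_{X A_i} = q_{A_i}`, `x_{X B_j} = q_{B_j}`, `x_{A_i B_j} = q_{A_i} + q_{B_j} - 2 q_{A_i B_j}`. -/
def cutOfCorr {α β : Type} (q : BellCoord α β → ℝ) : BellCoord α β → ℝ
  | Sum.inl i => q (BellCoord.a i)
  | Sum.inr (Sum.inl j) => q (BellCoord.b j)
  | Sum.inr (Sum.inr (i, j)) =>
      q (BellCoord.a i) + q (BellCoord.b j) - 2 * q (BellCoord.ab i j)

/-! ### Triangular elimination -/

/-- Pairs `i < i'` of elements of `Fin n`. -/
abbrev OrdPair (n : ℕ) : Type := {p : Fin n × Fin n // p.1 < p.2}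

/-- The nodes `X`, `A_i` (`i` in `Fin nA`), `B_j` (`j` in `Fin nB`) of the complete graph on
`1 + nA + nB` nodes. -/
inductive Node (nA nB : ℕ) : Type
  | X : Node nA nB
  | A (i : Fin nA) : Node nA nB
  | B (j : Fin nB) : Node nA nB

/-- Alice's observables after triangular elimination: the `A_i`, and a new `A'_{B_j B_{j'}}` for
every `j < j'`. -/
abbrev AliceObs (nA nB : ℕ) : Type := Fin nA ⊕ OrdPair nB

/-- Bob's observables after triangular elimination: the `B_j`, and a new `B'_{A_i A_{i'}}` for
every `i < i'`. -/
abbrev BobObs (nA nB : ℕ) : Type := Fin nB ⊕ OrdPair nA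

/-- Triangular elimination. The coefficients `u` of a linear inequality on the edges of the
complete graph on `1 + nA + nB` nodes are turned into coefficients on the edges of the complete
tripartite graph, where each term `u_{A_i A_{i'}} x_{A_i A_{i'}}` with `i < i'` is replaced by
`u_{A_i A_{i'}} x_{A_i B'} - |u_{A_i A_{i'}}| x_{A_{i'} B'}` with the new node
`B' = B'_{A_i A_{i'}}`, and similarly for `B_j B_{j'}`. The right-hand side does not change. -/
def triangularElimination {nA nB : ℕ} (u : Sym2 (Node nA nB) → ℝ) :
    BellCoord (AliceObs nA nB) (BobObs nA nB) → ℝ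
  | Sum.inl (Sum.inl i) => u s(Node.X, Node.A i)
  | Sum.inl (Sum.inr _) => 0
  | Sum.inr (Sum.inl (Sum.inl j)) => u s(Node.X, Node.B j)
  | Sum.inr (Sum.inl (Sum.inr _)) => 0
  | Sum.inr (Sum.inr (Sum.inl i, Sum.inl j)) => u s(Node.A i, Node.B j)
  | Sum.inr (Sum.inr (Sum.inl i, Sum.inr p)) =>
      if i = p.1.1 then u s(Node.A p.1.1, Node.A p.1.2)
      else if i = p.1.2 then -|u s(Node.A p.1.1, Node.A p.1.2)|
      else 0
  | Sum.inr (Sum.inr (Sum.inr p, Sum.inl j)) =>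
      if j = p.1.1 then u s(Node.B p.1.1, Node.B p.1.2)
      else if j = p.1.2 then -|u s(Node.B p.1.1, Node.B p.1.2)|
      else 0
  | Sum.inr (Sum.inr (Sum.inr _, Sum.inr _)) => 0

/-! ### Pure clique-web inequalities -/

/-- The web with parameters `p` and `r`: the nodes are `p` points on a circle, and two of them are
adjacent when their circular distance is at least `r + 1`, i.e. when
`r + 1 ≤ |i - j| ≤ p - r - 1`. (Its complement, the antiweb, joins nodes at circular distance
at most `r`.) -/
def webGraph (p r : ℕ) : SimpleGraph (Fin p) where
  Adj i j := (i.val + r < j.val ∧ j.val + r < i.val + p) ∨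
    (j.val + r < i.val ∧ i.val + r < j.val + p)
  symm := ⟨fun _ _ h => h.symm⟩
  loopless := ⟨fun i h => by omega⟩

instance (p r : ℕ) : DecidableRel (webGraph p r).Adj :=
  fun _ _ => inferInstanceAs (Decidable (_ ∨ _))

/-- Coefficients of the pure clique-web inequality with parameters `n = p + q`, `p`, `q`, `r`
(where `p - q = 2 r + 1`), as a function of two nodes: `1` on the edges of the web on the `p`
nodes, `0` on the edges of the antiweb, `1` on all the edges of the clique on the `q` nodes,
and `-1` on all the edges between the two parts. -/
def cliqueWebFun (p q r : ℕ) : Fin p ⊕ Fin q → Fin p ⊕ Fin q → ℝ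
  | Sum.inl i, Sum.inl j => if (webGraph p r).Adj i j then 1 else 0
  | Sum.inr _, Sum.inr _ => 1
  | Sum.inl _, Sum.inr _ => -1
  | Sum.inr _, Sum.inl _ => -1

theorem cliqueWebFun_comm (p q r : ℕ) (v w : Fin p ⊕ Fin q) :
    cliqueWebFun p q r v w = cliqueWebFun p q r w v := by
  rcases v with i | i <;> rcases w with j | j <;>
    simp [cliqueWebFun, (webGraph p r).adj_comm]

/-- The coefficients of the pure clique-web inequality (right-hand side `0`) on the edges of the
complete graph on `p + q` nodes. -/
def cliqueWebCoeff (p q r : ℕ) : Sym2 (Fin p ⊕ Fin q) → ℝ :=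
  Sym2.lift ⟨cliqueWebFun p q r, cliqueWebFun_comm p q r⟩

/-- The labelling of the `s + 1 + t` nodes of the clique-web inequality as
`A_1, …, A_s, X, B_1, …, B_t`, in this order. -/
def nodeLabel (s t : ℕ) : Node s t → Fin (s + 1) ⊕ Fin t
  | Node.A i => Sum.inl i.castSucc
  | Node.X => Sum.inl (Fin.last s)
  | Node.B j => Sum.inr j

/-- The coefficients of the pure clique-web inequality with parameters `n = s + t + 1`,
`p = s + 1`, `q = t` and `r`, on the relabelled nodes. -/
def labelledCliqueWeb (s t r : ℕ) (e : Sym2 (Node s t)) : ℝ :=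
  cliqueWebCoeff (s + 1) t r (e.map (nodeLabel s t))

/-- The coefficients of the Bell inequality
`-∑_{i=r+1}^{s-r} (i-r-1) q_{A_i} - t ∑_{i=s-r+1}^{s} q_{A_i} - ∑_{j=1}^{t} (j+r) q_{B_j}
  + ∑_{i=1}^{s} ∑_{j=1}^{t} q_{A_i B_j}
  + ∑_{1≤i<i'≤s, r+1≤i'-i≤s-r} (-q_{A_i B'_{ii'}} + q_{A_{i'} B'_{ii'}})
  + ∑_{1≤j<j'≤t} (-q_{A'_{jj'} B_j} + q_{A'_{jj'} B_{j'}}) ≤ 0`.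
The element `i` of `Fin n` stands for the index `i.val + 1`. -/
def pureCliqueWebBell (s t r : ℕ) : BellCoord (AliceObs s t) (BobObs s t) → ℝ
  | Sum.inl (Sum.inl i) =>
      if i.val + 1 < r + 1 then 0
      else if i.val + 1 ≤ s - r then -(((i.val + 1 : ℕ) : ℝ) - r - 1)
      else -(t : ℝ)
  | Sum.inl (Sum.inr _) => 0
  | Sum.inr (Sum.inl (Sum.inl j)) => -(((j.val + 1 : ℕ) : ℝ) + r)
  | Sum.inr (Sum.inl (Sum.inr _)) => 0
  | Sum.inr (Sum.inr (Sum.inl _, Sum.inl _)) => 1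
  | Sum.inr (Sum.inr (Sum.inl i, Sum.inr p)) =>
      if r + 1 ≤ p.1.2.val - p.1.1.val ∧ p.1.2.val - p.1.1.val ≤ s - r then
        if i = p.1.1 then -1 else if i = p.1.2 then 1 else 0
      else 0
  | Sum.inr (Sum.inr (Sum.inr p, Sum.inl j)) =>
      if j = p.1.1 then -1 else if j = p.1.2 then 1 else 0
  | Sum.inr (Sum.inr (Sum.inr _, Sum.inr _)) => 0

/-! Validity. Delete from the pure clique-web inequality one web node and one clique node on the
same side of the cut. By the triangle inequality the web cut drops by at most the distances to the
deleted node, and these cancel against the clique and mixed terms, so induction on the clique size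
applies (`webCut_succ_le`, `cliqueWebValue_nonpos`). Triangular elimination replaces an edge
`x_{AA'}` by `x_{AB'} - x_{A'B'} ≤ x_{AA'}`, so twice the Bell value of a classical configuration is
at most the clique-web value of the cut it induces.

Tightness. It suffices that a linear form `d` vanishing on all classical roots is a multiple of the
Bell form. The roots used make the true `A_i` an interval of length `m` and the true `B_j` a set `T`
with `m = r + #T` or `m = r + 1 + #T` (or `m ≤ r + 1` and `T` empty). Each new observable copies the
second endpoint of its edge; it is free when the endpoints agree, or when the edge is not in the
web. Flipping free new observables shows that their coefficients in `d` vanish, except for opposite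
values at the two endpoints of a clique or web edge. Flipping some `A_x` or `B_j` at two nearby
roots and comparing the results identifies these values with the coefficients of all `A_x B_j`,
hence with one constant `c`. Subtracting `c` times the Bell form leaves only single-observable
terms, which small intervals kill (`VanishesOnRoots.exists_eq_smul`). Duality then gives the
dimension (`isTightBellInequality_of_forall_eq_smul`). -/

open Finset

/-! ### Cuts of the web: insertion and rotation of nodes -/

/-- The indicator of `a ≠ b`. -/
def boolDist (a b : Bool) : ℝ := if a = b then 0 else 1

theorem boolDist_self (a : Bool) : boolDist a a = 0 := by simp [boolDist]

theorem boolDist_comm (a b : Bool) : boolDist a b = boolDist b a := by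
  cases a <;> cases b <;> simp [boolDist]

theorem boolDist_triangle (a b c : Bool) : boolDist a b ≤ boolDist a c + boolDist b c := by
  cases a <;> cases b <;> cases c <;> simp [boolDist]

theorem boolDist_not (a b : Bool) : boolDist (!a) (!b) = boolDist a b := by
  cases a <;> cases b <;> simp [boolDist]

/-- The number of edges of the web with parameters `p` and `r` that are cut by `σ`. -/
def webCut (r p : ℕ) (σ : ℕ → Bool) : ℝ :=
  ∑ l ∈ range p, ∑ k ∈ range p,
    if k + r < l ∧ l + r < k + p then boolDist (σ k) (σ l) else 0

/-- The number of `k < p` with `σ k`. -/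
def trueCount (p : ℕ) (σ : ℕ → Bool) : ℝ := ∑ k ∈ range p, if σ k then 1 else 0

theorem webCut_congr {r p : ℕ} {σ τ : ℕ → Bool} (h : ∀ k < p, σ k = τ k) :
    webCut r p σ = webCut r p τ := by
  unfold webCut
  refine sum_congr rfl fun l hl => sum_congr rfl fun k hk => ?_
  rw [h k (mem_range.1 hk), h l (mem_range.1 hl)]

theorem webCut_not (r p : ℕ) (σ : ℕ → Bool) : webCut r p (fun k => !σ k) = webCut r p σ := by
  simp only [webCut, boolDist_not]

theorem trueCount_nonneg (p : ℕ) (σ : ℕ → Bool) : 0 ≤ trueCount p σ :=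
  sum_nonneg fun k _ => by split_ifs <;> norm_num

theorem trueCount_eq_zero {p : ℕ} {σ : ℕ → Bool} (h : ∀ k < p, σ k = false) :
    trueCount p σ = 0 :=
  sum_eq_zero fun k hk => by simp [h k (mem_range.1 hk)]

theorem sum_boolDist_false (p : ℕ) (σ : ℕ → Bool) :
    ∑ k ∈ range p, boolDist (σ k) false = trueCount p σ :=
  sum_congr rfl fun k _ => by cases σ k <;> simp [boolDist]

theorem sum_boolDist_true (p : ℕ) (σ : ℕ → Bool) :
    ∑ k ∈ range p, boolDist (σ k) true = p - trueCount p σ := by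
  rw [eq_sub_iff_add_eq, trueCount, ← sum_add_distrib]
  calc _ = ∑ _k ∈ range p, (1 : ℝ) := sum_congr rfl fun k _ => by cases σ k <;> simp [boolDist]
    _ = p := by simp

theorem webCut_succ_eq_sum (r p : ℕ) (σ : ℕ → Bool) :
    webCut r (p + 1) σ = ∑ l ∈ range p, (∑ k ∈ range p,
      if k + r < l ∧ l + r < k + (p + 1) then boolDist (σ k) (σ l) else 0) +
      ∑ k ∈ range p, if k + r < p ∧ p + r < k + (p + 1) then boolDist (σ k) (σ p) else 0 := by
  unfold webCut
  rw [sum_range_succ, sum_range_succ _ p, if_neg (by omega), add_zero]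
  congr 1
  refine sum_congr rfl fun l hl => ?_
  rw [sum_range_succ, if_neg (by have := mem_range.1 hl; omega), add_zero]

/-- The effect on the cut of inserting one node into the circle. -/
theorem webCut_succ (r n : ℕ) (σ : ℕ → Bool) (hn : 0 < n) :
    webCut r (r + n + r + 1) σ = webCut r (r + n + r) σ
      + ∑ k ∈ range r, boolDist (σ k) (σ (r + n + k))
      + ∑ k ∈ range n, boolDist (σ (r + k)) (σ (r + n + r)) := by
  have hlast : ∑ k ∈ range (r + n + r), (if k + r < r + n + r ∧
      (r + n + r) + r < k + (r + n + r + 1) then boolDist (σ k) (σ (r + n + r)) else 0) =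
      ∑ k ∈ range n, boolDist (σ (r + k)) (σ (r + n + r)) := by
    rw [sum_range_add, sum_range_add]
    rw [sum_eq_zero (M := ℝ) (s := range r) fun k hk => if_neg (by have := mem_range.1 hk; omega),
      sum_eq_zero (M := ℝ) (s := range r) fun k hk => if_neg (by omega)]
    rw [zero_add, add_zero]
    exact sum_congr rfl fun k hk => if_pos (by have := mem_range.1 hk; omega)
  -- These pairs straddle the new node: their circular distance grows from `r` to `r + 1`, so they
  -- become adjacent.
  have hadd : ∑ l ∈ range (r + n + r), ∑ k ∈ range (r + n + r),
      (if l + r = k + (r + n + r) then boolDist (σ k) (σ l) else 0) =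
      ∑ k ∈ range r, boolDist (σ k) (σ (r + n + k)) := by
    have hz : ∀ l ∈ range (r + n), ∑ k ∈ range (r + n + r),
        (if l + r = k + (r + n + r) then boolDist (σ k) (σ l) else 0) = 0 := fun l hl =>
      sum_eq_zero fun k _ => if_neg (by have := mem_range.1 hl; omega)
    rw [sum_range_add, sum_eq_zero hz, zero_add]
    refine sum_congr rfl fun k hk => ?_
    have hk := mem_range.1 hk
    have hs : ∀ j ∈ range (r + n + r), j ≠ k → (if r + n + k + r = j + (r + n + r)
        then boolDist (σ j) (σ (r + n + k)) else 0) = 0 := fun j _ hj => if_neg (by omega)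
    rw [sum_eq_single_of_mem k (mem_range.2 (by omega)) hs, if_pos (by omega)]
  rw [webCut_succ_eq_sum, hlast, ← hadd, webCut, ← sum_add_distrib]
  congr 1
  refine sum_congr rfl fun l hl => ?_
  rw [← sum_add_distrib]
  refine sum_congr rfl fun k hk => ?_
  -- `hn` ensures that the newly adjacent pairs also satisfy `k + r < l`.
  split_ifs <;> first | omega | simp

/-- The ends of the `r` newly adjacent pairs are exactly the nodes that the new node is not joined
to, so each such pair can be rerouted through it. -/
theorem webCut_succ_le (r n : ℕ) (σ : ℕ → Bool) (hn : 0 < n) :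
    webCut r (r + n + r + 1) σ ≤ webCut r (r + n + r) σ
      + ∑ k ∈ range (r + n + r), boolDist (σ k) (σ (r + n + r)) := by
  rw [webCut_succ r n σ hn, sum_range_add, sum_range_add]
  have := sum_le_sum fun (k : ℕ) (_ : k ∈ range r) =>
    boolDist_triangle (σ k) (σ (r + n + k)) (σ (r + n + r))
  rw [sum_add_distrib] at this
  linarith

theorem webCut_rotate {r p : ℕ} {σ τ : ℕ → Bool} (h : ∀ k < p, τ k = σ (k + 1))
    (h0 : τ p = σ 0) : webCut r (p + 1) τ = webCut r (p + 1) σ := by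
  have hσ : webCut r (p + 1) σ = ∑ l ∈ range p, (∑ k ∈ range p,
      if k + 1 + r < l + 1 ∧ l + 1 + r < k + 1 + (p + 1)
      then boolDist (σ (k + 1)) (σ (l + 1)) else 0) +
      ∑ l ∈ range p, if 0 + r < l + 1 ∧ l + 1 + r < 0 + (p + 1)
      then boolDist (σ 0) (σ (l + 1)) else 0 := by
    unfold webCut
    have hz : ∀ k ∈ range (p + 1), (if k + r < 0 ∧ 0 + r < k + (p + 1)
        then boolDist (σ k) (σ 0) else 0) = 0 := fun k _ => if_neg (by omega)
    rw [sum_range_succ', sum_eq_zero hz, add_zero, ← sum_add_distrib]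
    exact sum_congr rfl fun l _ => sum_range_succ' _ p
  rw [webCut_succ_eq_sum, hσ]
  congr 1
  · refine sum_congr rfl fun l hl => sum_congr rfl fun k hk => ?_
    rw [h l (mem_range.1 hl), h k (mem_range.1 hk)]
    exact if_congr (by omega) rfl rfl
  · refine sum_congr rfl fun k hk => ?_
    rw [h k (mem_range.1 hk), h0, boolDist_comm]
    have := mem_range.1 hk
    exact if_congr (by omega) rfl rfl

theorem trueCount_rotate {p : ℕ} {σ τ : ℕ → Bool} (h : ∀ k < p, τ k = σ (k + 1))
    (h0 : τ p = σ 0) : trueCount (p + 1) τ = trueCount (p + 1) σ := by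
  unfold trueCount
  rw [sum_range_succ, sum_range_succ' _ p, h0]
  congr 1
  exact sum_congr rfl fun k hk => by rw [h k (mem_range.1 hk)]

/-- Any node of the circle can be rotated into the last position. -/
theorem exists_rotation (r p : ℕ) (b : Bool) (i : ℕ) : ∀ σ : ℕ → Bool, i ≤ p → σ i = b →
    ∃ τ : ℕ → Bool, webCut r (p + 1) τ = webCut r (p + 1) σ ∧
      trueCount (p + 1) τ = trueCount (p + 1) σ ∧ τ p = b := by
  induction i with
  | zero =>
    intro σ _ hb
    have h : ∀ k < p, (fun k => if k < p then σ (k + 1) else σ 0) k = σ (k + 1) :=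
      fun k hk => by simp [hk]
    exact ⟨_, webCut_rotate h (by simp), trueCount_rotate h (by simp), by simp [hb]⟩
  | succ i ih =>
    intro σ hi hb
    have h : ∀ k < p, (fun k => if k < p then σ (k + 1) else σ 0) k = σ (k + 1) :=
      fun k hk => by simp [hk]
    obtain ⟨τ, h1, h2, h3⟩ := ih (fun k => if k < p then σ (k + 1) else σ 0) (by omega)
      (by simp [show i < p by omega, hb])
    exact ⟨τ, h1.trans (webCut_rotate h (by simp)), h2.trans (trueCount_rotate h (by simp)), h3⟩

/-! ### Validity of the clique-web inequality -/

/-- The left-hand side of the pure clique-web inequality with `2 r + 1 + q` web nodes at the cut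
given by `σ` and by `y` of the `q` clique nodes. -/
def cliqueWebValue (r q : ℕ) (σ : ℕ → Bool) (y : ℝ) : ℝ :=
  webCut r (r + (q + 1) + r) σ + y * (q - y) - trueCount (r + (q + 1) + r) σ * (q - y)
    - ((r + (q + 1) + r : ℕ) - trueCount (r + (q + 1) + r) σ) * y

theorem webCut_eq_zero (r p : ℕ) (σ : ℕ → Bool) (hp : p ≤ r + 1 + r) : webCut r p σ = 0 :=
  sum_eq_zero fun l _ => sum_eq_zero fun k _ => if_neg (by omega)

/-- The pure clique-web inequality is valid. -/
theorem cliqueWebValue_nonpos (r q : ℕ) : ∀ (σ : ℕ → Bool) (y : ℕ), y ≤ q →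
    cliqueWebValue r q σ y ≤ 0 := by
  induction q with
  | zero =>
    intro σ y hy
    obtain rfl : y = 0 := by omega
    simp [cliqueWebValue, webCut_eq_zero]
  | succ q ih =>
    -- The last web node is deleted together with a clique node on its side; the extra condition
    -- says that such a clique node exists.
    have key : ∀ (σ : ℕ → Bool) (y : ℕ), y ≤ q + 1 →
        (if σ (r + (q + 1) + r) then 1 ≤ y else y ≤ q) → cliqueWebValue r (q + 1) σ y ≤ 0 := by
      intro σ y hy h
      have hle := webCut_succ_le r (q + 1) σ (by omega)
      have hc : trueCount (r + (q + 1) + r + 1) σ = _ := sum_range_succ _ _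
      rw [show ∑ k ∈ range (r + (q + 1) + r), (if σ k then (1 : ℝ) else 0) =
        trueCount (r + (q + 1) + r) σ from rfl] at hc
      have hp : r + (q + 1 + 1) + r = r + (q + 1) + r + 1 := by ring
      unfold cliqueWebValue at ih ⊢
      rw [hp]
      cases hσ : σ (r + (q + 1) + r)
      · rw [hσ] at hc
        simp only [hσ] at h hle
        have := ih σ y (by simpa using h)
        rw [sum_boolDist_false] at hle
        rw [hc, if_neg Bool.false_ne_true]
        push_cast at this ⊢
        linarith
      · rw [hσ] at hc
        simp only [hσ] at h hle
        obtain ⟨y, rfl⟩ : ∃ z, y = z + 1 := ⟨y - 1, by simp at h; omega⟩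
        have := ih σ y (by omega)
        rw [sum_boolDist_true] at hle
        rw [hc, if_pos rfl]
        push_cast at this hle ⊢
        linarith
    intro σ y hy
    by_cases h : if σ (r + (q + 1) + r) then 1 ≤ y else y ≤ q
    · exact key σ y hy h
    -- Otherwise all clique nodes lie opposite the last web node. A web node on their side is
    -- rotated into the last place; if there is none, the web is not cut and the sign is visible.
    · have hrot : ∀ b : Bool, (if b then 1 ≤ y else y ≤ q) → ∀ i ≤ r + (q + 1) + r, σ i = b →
          cliqueWebValue r (q + 1) σ y ≤ 0 := by
        intro b hb i hi hσ
        obtain ⟨τ, h1, h2, h3⟩ := exists_rotation r (r + (q + 1) + r) b i σ hi hσ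
        have := key τ y hy (by rw [h3]; exact hb)
        unfold cliqueWebValue at this ⊢
        rw [show r + (q + 1 + 1) + r = r + (q + 1) + r + 1 by ring] at this ⊢
        rwa [← h1, ← h2]
      rcases Nat.eq_zero_or_pos y with rfl | hy0
      · by_cases hall : ∀ k < r + (q + 1 + 1) + r, σ k = true
        · unfold cliqueWebValue
          have hW : webCut r (r + (q + 1 + 1) + r) σ = 0 :=
            sum_eq_zero fun l hl => sum_eq_zero fun k hk => by
              rw [hall l (mem_range.1 hl), hall k (mem_range.1 hk), boolDist_self, ite_self]
          have := trueCount_nonneg (r + (q + 1 + 1) + r) σ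
          rw [hW]
          push_cast
          nlinarith [Nat.cast_nonneg (α := ℝ) q]
        · push Not at hall
          obtain ⟨k, hk, hσ⟩ := hall
          exact hrot false (by simp) k (by omega) (by simpa using hσ)
      · by_cases hall : ∀ k < r + (q + 1 + 1) + r, σ k = false
        · unfold cliqueWebValue
          have hW : webCut r (r + (q + 1 + 1) + r) σ = 0 :=
            sum_eq_zero fun l hl => sum_eq_zero fun k hk => by
              rw [hall l (mem_range.1 hl), hall k (mem_range.1 hk), boolDist_self, ite_self]
          rw [hW, trueCount_eq_zero hall]
          have : (y : ℝ) ≤ q + 1 := by exact_mod_cast hy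
          push_cast
          nlinarith [q.cast_nonneg (α := ℝ), mul_nonneg (y.cast_nonneg (α := ℝ)) (r.cast_nonneg),
            mul_nonneg (y.cast_nonneg (α := ℝ)) (y.cast_nonneg)]
        · push Not at hall
          obtain ⟨k, hk, hσ⟩ := hall
          exact hrot true (by rw [if_pos rfl]; exact hy0) k (by omega) (by simpa using hσ)

/-! ### Roots of the clique-web inequality from intervals -/

/-- The indicator of the interval `[u, u + m)`. -/
def intervalInd (u m k : ℕ) : Bool := decide (u ≤ k ∧ k < u + m)

theorem sum_range_ite_mem_Ico (n lo hi : ℕ) :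
    ∑ k ∈ range n, (if lo ≤ k ∧ k < hi then (1 : ℝ) else 0) = (min hi n - lo : ℕ) := by
  rw [sum_boole, show ({k ∈ range n | lo ≤ k ∧ k < hi} : Finset ℕ) = Ico lo (min hi n) by
    ext k; simp only [mem_filter, mem_range, mem_Ico]; omega, Nat.card_Ico]

theorem trueCount_intervalInd {p u m : ℕ} (h : u + m ≤ p) :
    trueCount p (intervalInd u m) = m := by
  have := sum_range_ite_mem_Ico p u (u + m)
  simp only [trueCount, intervalInd, decide_eq_true_eq]
  rw [this]
  congr 1
  omega

theorem webCut_intervalInd_zero {r p m u : ℕ} (h : u + m ≤ p) :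
    webCut r p (intervalInd u m) = webCut r p (intervalInd 0 m) := by
  induction u with
  | zero => rfl
  | succ u ih =>
    rw [← ih (by omega)]
    obtain ⟨p, rfl⟩ : ∃ n, p = n + 1 := ⟨p - 1, by omega⟩
    refine (webCut_rotate (fun k _ => ?_) ?_).symm
    · simp only [intervalInd, decide_eq_decide]; omega
    · simp only [intervalInd, decide_eq_decide]; omega

/-- Every new edge has one end at or beyond `r + n`, outside the interval, and the other ends run
once through `[0, r + n)`, which contains it. -/
theorem webCut_succ_intervalInd {r n m : ℕ} (hn : 0 < n) (hm : m ≤ r + n) :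
    webCut r (r + n + r + 1) (intervalInd 0 m) = webCut r (r + n + r) (intervalInd 0 m) + m := by
  have hf : ∀ k, intervalInd 0 m (r + n + k) = false := fun k => by
    simp only [intervalInd, decide_eq_false_iff_not]; omega
  rw [webCut_succ r n _ hn, add_assoc]
  simp only [hf]
  rw [← sum_range_add (fun k => boolDist (intervalInd 0 m k) false), sum_boolDist_false,
    trueCount_intervalInd (by omega)]

/-- A web node has degree `q`, and so short an interval contains no web edge. -/
theorem webCut_short_interval {r q m u : ℕ} (hm : m ≤ r + 1) (h : u + m ≤ r + (q + 1) + r) :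
    webCut r (r + (q + 1) + r) (intervalInd u m) = m * q := by
  rw [webCut_intervalInd_zero h]
  clear h
  induction q with
  | zero => simp [webCut_eq_zero]
  | succ q ih =>
    rw [show r + (q + 1 + 1) + r = r + (q + 1) + r + 1 by ring,
      webCut_succ_intervalInd (by omega) (by omega), ih]
    push_cast
    ring

theorem webCut_long_interval {r i j u : ℕ} (h : u + (r + 1 + j) ≤ r + (j + i + 1) + r) :
    webCut r (r + (j + i + 1) + r) (intervalInd u (r + 1 + j)) = r * j + i * (r + 1 + j) := by
  rw [webCut_intervalInd_zero h]
  clear h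
  induction i with
  | zero =>
    -- For `i = 0` the complement is an interval of length `r`, which is short.
    rw [← webCut_not, webCut_congr (τ := intervalInd (r + 1 + j) r),
      webCut_short_interval (by omega) (by omega)]
    · simp
    · intro k hk
      rw [Bool.eq_iff_iff]
      simp only [intervalInd, Bool.not_eq_true', decide_eq_false_iff_not, decide_eq_true_eq]
      omega
  | succ i ih =>
    rw [show r + (j + (i + 1) + 1) + r = r + (j + i + 1) + r + 1 by ring,
      webCut_succ_intervalInd (by omega) (by omega), ih]
    push_cast
    ring

/-- For `m = r + 1 + j` the value is `-(y - j) * (y - j - 1)`, which vanishes at `y = j` and `y = j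
+ 1`. -/
theorem cliqueWebValue_interval {r q u m y : ℕ} (h : u + m ≤ r + (q + 1) + r)
    (hm : m ≤ r + q + 1) (hy : m ≤ r + 1 ∧ y = 0 ∨ m = r + y ∨ m = r + 1 + y) :
    cliqueWebValue r q (intervalInd u m) y = 0 := by
  unfold cliqueWebValue
  rw [trueCount_intervalInd h]
  by_cases h1 : m ≤ r + 1 ∧ y = 0
  · obtain ⟨h1, rfl⟩ := h1
    rw [webCut_short_interval h1 h]
    simp
  · obtain ⟨j, rfl⟩ : ∃ j, m = r + 1 + j := ⟨m - (r + 1), by omega⟩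
    obtain ⟨i, rfl⟩ : ∃ i, q = j + i := ⟨q - j, by omega⟩
    rw [webCut_long_interval h]
    obtain rfl | rfl : y = j + 1 ∨ y = j := by omega
    all_goals push_cast; ring

/-! ### The Bell inequality as a triangular elimination -/

theorem sum_ordPair {n : ℕ} (f : Fin n → Fin n → ℝ) :
    ∑ p : OrdPair n, f p.1.1 p.1.2 = ∑ i, ∑ j, if i < j then f i j else 0 := by
  rw [← Fintype.sum_prod_type' (f := fun i j => if i < j then f i j else 0), ← sum_filter]
  exact (sum_subtype _ (by simp) fun x : Fin n × Fin n => f x.1 x.2).symm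

/-- The indicator of the pairs `i < i'` with `r + 1 ≤ i' - i ≤ s - r`. -/
def webInd {s : ℕ} (r : ℕ) (p : OrdPair s) : ℝ :=
  if r + 1 ≤ p.1.2.val - p.1.1.val ∧ p.1.2.val - p.1.1.val ≤ s - r then 1 else 0

theorem sum_ite_pair {ι : Type} [Fintype ι] [DecidableEq ι] {i j : ι} (h : i ≠ j) (u v : ℝ)
    (x : ι → ℝ) :
    ∑ k, (if k = i then u else if k = j then v else 0) * x k = u * x i + v * x j := by
  rw [← sum_subset (subset_univ {i, j}) fun k _ hk => ?_, sum_pair h, if_pos rfl, if_neg h.symm,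
    if_pos rfl]
  simp only [mem_insert, mem_singleton, not_or] at hk
  rw [if_neg hk.1, if_neg hk.2, zero_mul]

section Coefficients

variable {s t r : ℕ}

theorem labelledCliqueWeb_X_A (i : Fin s) : labelledCliqueWeb s t r s(Node.X, Node.A i) =
    if r ≤ i.val ∧ i.val + r < s then 1 else 0 := by
  simp only [labelledCliqueWeb, cliqueWebCoeff, nodeLabel, cliqueWebFun, Sym2.map_mk,
    Sym2.lift_mk, webGraph]
  have := i.2
  refine if_congr ?_ rfl rfl
  simp only [Fin.val_last, Fin.val_castSucc]
  omega

theorem labelledCliqueWeb_A_A (hr : r ≤ s) (p : OrdPair s) :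
    labelledCliqueWeb s t r s(Node.A p.1.1, Node.A p.1.2) = webInd r p := by
  simp only [labelledCliqueWeb, cliqueWebCoeff, nodeLabel, cliqueWebFun, Sym2.map_mk,
    Sym2.lift_mk, webGraph, webInd]
  have : p.1.1.val < p.1.2.val := p.2
  refine if_congr ?_ rfl rfl
  simp only [Fin.val_castSucc]
  omega

theorem labelledCliqueWeb_X_B (j : Fin t) : labelledCliqueWeb s t r s(Node.X, Node.B j) = -1 :=
  rfl

theorem labelledCliqueWeb_A_B (i : Fin s) (j : Fin t) :
    labelledCliqueWeb s t r s(Node.A i, Node.B j) = -1 :=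
  rfl

theorem labelledCliqueWeb_B_B (j k : Fin t) :
    labelledCliqueWeb s t r s(Node.B j, Node.B k) = 1 :=
  rfl

theorem webInd_nonneg (p : OrdPair s) : 0 ≤ webInd r p := by
  unfold webInd; split_ifs <;> norm_num

theorem linForm_bellCoord {α β : Type} [Fintype α] [Fintype β] (c x : BellCoord α β → ℝ) :
    linForm c x = ∑ i, c (.a i) * x (.a i) + (∑ j, c (.b j) * x (.b j) +
      ∑ i, ∑ j, c (.ab i j) * x (.ab i j)) := by
  simp only [linForm, Fintype.sum_sum_type, Fintype.sum_prod_type]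

theorem linForm_triangularElimination (hr : r ≤ s)
    (x : BellCoord (AliceObs s t) (BobObs s t) → ℝ) :
    linForm (triangularElimination (labelledCliqueWeb s t r)) x =
      ∑ i : Fin s, (if r ≤ i.val ∧ i.val + r < s then 1 else 0) * x (.a (.inl i))
      - ∑ j, x (.b (.inl j)) - ∑ i, ∑ j, x (.ab (.inl i) (.inl j))
      + ∑ p : OrdPair s, webInd r p *
        (x (.ab (.inl p.1.1) (.inr p)) - x (.ab (.inl p.1.2) (.inr p)))
      + ∑ q : OrdPair t, (x (.ab (.inr q) (.inl q.1.1)) - x (.ab (.inr q) (.inl q.1.2))) := by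
  rw [linForm_bellCoord]
  simp only [Fintype.sum_sum_type, triangularElimination, labelledCliqueWeb_X_A,
    labelledCliqueWeb_X_B, labelledCliqueWeb_A_A hr, labelledCliqueWeb_A_B,
    labelledCliqueWeb_B_B, zero_mul, sum_const_zero, add_zero, sum_add_distrib]
  rw [sum_comm (s := (univ : Finset (Fin s))) (t := (univ : Finset (OrdPair s)))]
  have h1 : ∀ p : OrdPair s, ∑ i, (if i = p.1.1 then webInd r p else if i = p.1.2 then
      -|webInd r p| else 0) * x (.ab (.inl i) (.inr p)) = webInd r p *
        (x (.ab (.inl p.1.1) (.inr p)) - x (.ab (.inl p.1.2) (.inr p))) := fun p => by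
    rw [sum_ite_pair p.2.ne _ _ fun i => x (.ab (.inl i) (.inr p)), abs_of_nonneg
      (webInd_nonneg p)]
    ring
  have h2 : ∀ q : OrdPair t, ∑ j, (if j = q.1.1 then 1 else if j = q.1.2 then
      -|(1 : ℝ)| else 0) * x (.ab (.inr q) (.inl j)) =
        (x (.ab (.inr q) (.inl q.1.1)) - x (.ab (.inr q) (.inl q.1.2))) := fun q => by
    rw [sum_ite_pair q.2.ne _ _ fun j => x (.ab (.inr q) (.inl j)), abs_one]
    ring
  simp only [h1, h2, neg_one_mul, sum_neg_distrib]
  ring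

theorem linForm_pureCliqueWebBell (x : BellCoord (AliceObs s t) (BobObs s t) → ℝ) :
    linForm (pureCliqueWebBell s t r) x =
      ∑ i : Fin s, (if i.val < r then 0 else if i.val + 1 ≤ s - r then -((i.val : ℝ) - r)
        else -(t : ℝ)) * x (.a (.inl i))
      + ∑ j : Fin t, (-((j.val : ℝ) + 1 + r)) * x (.b (.inl j))
      + ∑ i, ∑ j, x (.ab (.inl i) (.inl j))
      + ∑ p : OrdPair s, webInd r p *
        (-x (.ab (.inl p.1.1) (.inr p)) + x (.ab (.inl p.1.2) (.inr p)))
      + ∑ q : OrdPair t, (-x (.ab (.inr q) (.inl q.1.1)) + x (.ab (.inr q) (.inl q.1.2))) := by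
  rw [linForm_bellCoord]
  simp only [Fintype.sum_sum_type, pureCliqueWebBell, zero_mul, sum_const_zero, add_zero,
    sum_add_distrib, one_mul, add_lt_add_iff_right]
  rw [sum_comm (s := (univ : Finset (Fin s))) (t := (univ : Finset (OrdPair s)))]
  have h1 : ∀ p : OrdPair s, ∑ i, (if r + 1 ≤ p.1.2.val - p.1.1.val ∧
        p.1.2.val - p.1.1.val ≤ s - r then
      if i = p.1.1 then (-1 : ℝ) else if i = p.1.2 then 1 else 0 else 0) *
        x (.ab (.inl i) (.inr p)) = webInd r p *
        (-x (.ab (.inl p.1.1) (.inr p)) + x (.ab (.inl p.1.2) (.inr p))) := fun p => by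
    unfold webInd
    split_ifs
    · rw [sum_ite_pair p.2.ne _ _ fun i => x (.ab (.inl i) (.inr p))]
      ring
    · simp
  have h2 : ∀ q : OrdPair t, ∑ j, (if j = q.1.1 then (-1 : ℝ) else if j = q.1.2 then
      1 else 0) * x (.ab (.inr q) (.inl j)) =
        (-x (.ab (.inr q) (.inl q.1.1)) + x (.ab (.inr q) (.inl q.1.2))) := fun q => by
    rw [sum_ite_pair q.2.ne _ _ fun j => x (.ab (.inr q) (.inl j))]
    ring
  have h3 : ∀ i : Fin s, (i.val : ℝ) + 1 - r - 1 = i.val - r := fun i => by ring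
  simp only [h1, h2, Nat.cast_add, Nat.cast_one, h3, sum_add_distrib]
  ring

end Coefficients

theorem sum_ordPair_sub {n : ℕ} (w : ℕ → ℕ → Prop) [∀ i j, Decidable (w i j)] (x : Fin n → ℝ) :
    ∑ p : OrdPair n, (if w p.1.1 p.1.2 then (1 : ℝ) else 0) * (x p.1.1 - x p.1.2) =
      ∑ i : Fin n, (∑ j ∈ range n, (if i.val < j ∧ w i j then (1 : ℝ) else 0) -
        ∑ j ∈ range n, (if j < i.val ∧ w j i then (1 : ℝ) else 0)) * x i := by
  rw [sum_ordPair fun i j => (if w i j then (1 : ℝ) else 0) * (x i - x j)]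
  simp only [sub_mul, sum_sub_distrib, sum_mul]
  conv_rhs =>
    congr
    · congr; · skip
      ext i
      rw [← Fin.sum_univ_eq_sum_range (fun j => (if i.val < j ∧ w i j then (1 : ℝ) else 0) * x i)]
    · congr; · skip
      ext i
      rw [← Fin.sum_univ_eq_sum_range (fun j => (if j < i.val ∧ w j i then (1 : ℝ) else 0) * x i)]
  conv_rhs =>
    congr
    · skip
    · rw [sum_comm]
  rw [← sum_sub_distrib]
  refine sum_congr rfl fun i _ => ?_
  rw [← sum_sub_distrib]
  refine sum_congr rfl fun j _ => ?_
  simp only [Fin.val_fin_lt]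
  by_cases h1 : i < j <;> by_cases h2 : w i j <;> simp [h1, h2]

/-- The eliminated coefficients are nonnegative, so the single terms of the new observables cancel.
What remains at `A_i` is its `X` edge, plus its later minus its earlier web neighbours, minus `t`;
similarly at `B_j`. -/
theorem linForm_triangularElimination_cutOfCorr (t r : ℕ) (ht : 0 < t)
    (q : BellCoord (AliceObs (t + 2 * r) t) (BobObs (t + 2 * r) t) → ℝ) :
    linForm (triangularElimination (labelledCliqueWeb (t + 2 * r) t r)) (cutOfCorr q) =
      2 * linForm (pureCliqueWebBell (t + 2 * r) t r) q := by
  have hA := sum_ordPair_sub (n := t + 2 * r)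
    (fun i j => r + 1 ≤ j - i ∧ j - i ≤ t + 2 * r - r) fun i => q (.a (.inl i))
  have hB := sum_ordPair_sub (n := t) (fun _ _ => True) fun j => q (.b (.inl j))
  -- Later web neighbours fill `[i + r + 1, i + t + r + 1)`, truncated at `s = t + 2 * r`.
  have hup : ∀ i : Fin (t + 2 * r), ∑ j ∈ range (t + 2 * r), (if i.val < j ∧
      (r + 1 ≤ j - i.val ∧ j - i.val ≤ t + 2 * r - r) then (1 : ℝ) else 0) =
      (min (i.val + t + r + 1) (t + 2 * r) - (i + r + 1) : ℕ) := fun i => by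
    rw [← sum_range_ite_mem_Ico]
    exact sum_congr rfl fun j _ => if_congr (by omega) rfl rfl
  have hdn : ∀ i : Fin (t + 2 * r), ∑ j ∈ range (t + 2 * r), (if j < i.val ∧
      (r + 1 ≤ i.val - j ∧ i.val - j ≤ t + 2 * r - r) then (1 : ℝ) else 0) =
      (min (i.val - r) (t + 2 * r) - (i - (t + r)) : ℕ) := fun i => by
    rw [← sum_range_ite_mem_Ico]
    exact sum_congr rfl fun j _ => if_congr (by omega) rfl rfl
  have hBup : ∀ i : Fin t, ∑ j ∈ range t, (if i.val < j ∧ True then (1 : ℝ) else 0) =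
      (min t t - (i + 1) : ℕ) := fun i => by
    rw [← sum_range_ite_mem_Ico]
    exact sum_congr rfl fun j hj => if_congr (by
      have := mem_range.1 hj; simp only [and_true]; omega) rfl rfl
  have hBdn : ∀ i : Fin t, ∑ j ∈ range t, (if j < i.val ∧ True then (1 : ℝ) else 0) =
      (min i.val t - 0 : ℕ) := fun i => by
    rw [← sum_range_ite_mem_Ico]
    exact sum_congr rfl fun j _ => if_congr (by simp only [and_true]; omega) rfl rfl
  simp only [hup, hdn] at hA
  simp only [hBup, hBdn, if_true, one_mul] at hB
  rw [linForm_triangularElimination (by omega), linForm_pureCliqueWebBell]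
  have hAA : ∑ i : Fin (t + 2 * r), (if r ≤ i.val ∧ i.val + r < t + 2 * r then 1 else 0) *
      q (.a (.inl i)) + ∑ p : OrdPair (t + 2 * r), webInd r p *
      (q (.a (.inl p.1.1)) - q (.a (.inl p.1.2))) - t * ∑ i : Fin (t + 2 * r), q (.a (.inl i)) =
      2 * ∑ i : Fin (t + 2 * r), (if i.val < r then 0 else if i.val + 1 ≤ t + 2 * r - r then
        -((i.val : ℝ) - r) else -(t : ℝ)) * q (.a (.inl i)) := by
    unfold webInd
    rw [hA, mul_sum, mul_sum, ← sum_add_distrib, ← sum_sub_distrib]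
    refine sum_congr rfl fun i _ => ?_
    rw [← mul_assoc, ← add_mul, ← sub_mul]
    congr 1
    have hi := i.2
    by_cases h1 : i.val < r
    · rw [if_neg (by omega), if_pos h1, show min (i.val + t + r + 1) (t + 2 * r) - (i.val + r + 1)
        = t by omega, show min (i.val - r) (t + 2 * r) - (i.val - (t + r)) = 0 by omega]
      simp
    · obtain ⟨k, hk⟩ : ∃ k, i.val = r + k := ⟨i - r, by omega⟩
      by_cases h2 : i.val + 1 ≤ t + 2 * r - r
      -- Here `l` counts later and `k` earlier neighbours, so the coefficient is `1 + l - k - t = -2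
      -- * k`.
      · obtain ⟨l, hl⟩ : ∃ l, t = k + l + 1 := ⟨t - k - 1, by omega⟩
        rw [if_pos (by omega), if_neg h1, if_pos h2,
          show min (i.val + t + r + 1) (t + 2 * r) - (i.val + r + 1) = l by omega,
          show min (i.val - r) (t + 2 * r) - (i.val - (t + r)) = k by omega]
        have hl' : (t : ℝ) = k + l + 1 := by exact_mod_cast hl
        have hk' : (i.val : ℝ) = r + k := by exact_mod_cast hk
        rw [hl', hk']
        ring
      · rw [if_neg (by omega), if_neg h1, if_neg h2,
          show min (i.val + t + r + 1) (t + 2 * r) - (i.val + r + 1) = 0 by omega,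
          show min (i.val - r) (t + 2 * r) - (i.val - (t + r)) = t by omega]
        push_cast
        ring
  have hBB : - ∑ j : Fin t, q (.b (.inl j)) - (t + 2 * r : ℕ) * ∑ j : Fin t, q (.b (.inl j))
      + ∑ p : OrdPair t, (q (.b (.inl p.1.1)) - q (.b (.inl p.1.2))) =
      2 * ∑ j : Fin t, (-((j.val : ℝ) + 1 + r)) * q (.b (.inl j)) := by
    rw [hB, mul_sum, mul_sum, ← sum_neg_distrib, ← sum_sub_distrib, ← sum_add_distrib]
    refine sum_congr rfl fun j _ => ?_
    obtain ⟨l, hl⟩ : ∃ l, t = j.val + l + 1 := ⟨t - j - 1, by omega⟩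
    rw [show min t t - (j.val + 1) = l by omega, show min j.val t - 0 = j.val by omega]
    have hl' : (t : ℝ) = j.val + l + 1 := by exact_mod_cast hl
    push_cast
    rw [hl']
    ring
  have hp : ∑ p : OrdPair (t + 2 * r), webInd r p * (cutOfCorr q (.ab (.inl p.1.1) (.inr p))
      - cutOfCorr q (.ab (.inl p.1.2) (.inr p))) = ∑ p : OrdPair (t + 2 * r), webInd r p *
      (q (.a (.inl p.1.1)) - q (.a (.inl p.1.2))) + 2 * ∑ p : OrdPair (t + 2 * r), webInd r p *
      (-q (.ab (.inl p.1.1) (.inr p)) + q (.ab (.inl p.1.2) (.inr p))) := by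
    rw [mul_sum, ← sum_add_distrib]
    refine sum_congr rfl fun p _ => ?_
    simp only [cutOfCorr]
    ring
  have hq : ∑ p : OrdPair t, (cutOfCorr q (.ab (.inr p) (.inl p.1.1))
      - cutOfCorr q (.ab (.inr p) (.inl p.1.2))) = ∑ p : OrdPair t,
      (q (.b (.inl p.1.1)) - q (.b (.inl p.1.2))) + 2 * ∑ p : OrdPair t,
      (-q (.ab (.inr p) (.inl p.1.1)) + q (.ab (.inr p) (.inl p.1.2))) := by
    rw [mul_sum, ← sum_add_distrib]
    refine sum_congr rfl fun p _ => ?_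
    simp only [cutOfCorr]
    ring
  rw [hp, hq]
  simp only [cutOfCorr, sum_add_distrib, sum_sub_distrib, ← mul_sum, sum_const, card_univ,
    Fintype.card_fin, nsmul_eq_mul] at *
  linarith

/-! ### Bell values of classical configurations -/

/-- Extension of a 0/1-labelling of `A_1, …, A_s` by `false`, in particular at `X`. -/
def extendFalse {s : ℕ} (a : Fin s → Bool) (k : ℕ) : Bool := if h : k < s then a ⟨k, h⟩ else false

theorem extendFalse_val {s : ℕ} (a : Fin s → Bool) (i : Fin s) : extendFalse a i = a i := by
  simp [extendFalse]

theorem extendFalse_self {s : ℕ} (a : Fin s → Bool) : extendFalse a s = false := by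
  simp [extendFalse]

theorem trueCount_extendFalse {s : ℕ} (a : Fin s → Bool) :
    trueCount (s + 1) (extendFalse a) = ∑ i, if a i then 1 else 0 := by
  rw [trueCount, sum_range_succ, extendFalse_self, if_neg Bool.false_ne_true, add_zero,
    ← Fin.sum_univ_eq_sum_range fun k => if extendFalse a k then (1 : ℝ) else 0]
  simp only [extendFalse_val]

theorem webCut_extendFalse {r s : ℕ} (hr : r ≤ s) (a : Fin s → Bool) :
    webCut r (s + 1) (extendFalse a) =
      ∑ i : Fin s, (if r ≤ i.val ∧ i.val + r < s then 1 else 0) * boolDist (a i) false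
      + ∑ p : OrdPair s, webInd r p * boolDist (a p.1.1) (a p.1.2) := by
  have h := sum_ordPair fun i j : Fin s => (if r + 1 ≤ j.val - i.val ∧ j.val - i.val ≤ s - r
    then 1 else 0) * boolDist (a i) (a j)
  unfold webInd
  rw [h, sum_comm, webCut_succ_eq_sum, add_comm]
  congr 1
  · rw [← Fin.sum_univ_eq_sum_range fun k => if k + r < s ∧ s + r < k + (s + 1) then
      boolDist (extendFalse a k) (extendFalse a s) else 0]
    refine sum_congr rfl fun i _ => ?_
    rw [extendFalse_val, extendFalse_self, ite_mul, one_mul, zero_mul]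
    exact if_congr (by omega) rfl rfl
  · rw [← Fin.sum_univ_eq_sum_range fun l => ∑ k ∈ range s, if k + r < l ∧ l + r < k + (s + 1)
      then boolDist (extendFalse a k) (extendFalse a l) else 0]
    refine sum_congr rfl fun j _ => ?_
    rw [← Fin.sum_univ_eq_sum_range fun k => if k + r < j ∧ j + r < k + (s + 1)
      then boolDist (extendFalse a k) (extendFalse a j) else 0]
    refine sum_congr rfl fun i _ => ?_
    rw [extendFalse_val, extendFalse_val, ite_mul, one_mul, zero_mul, ← ite_and]
    refine if_congr ?_ rfl rfl
    rw [Fin.lt_def]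
    omega

theorem sum_boolDist_left {ι : Type} [Fintype ι] (c : Bool) (b : ι → Bool) :
    ∑ j, boolDist c (b j) = (if c then 1 else 0) * (Fintype.card ι - ∑ j, if b j then (1 : ℝ) else 0)
      + (1 - if c then 1 else 0) * ∑ j, if b j then (1 : ℝ) else 0 := by
  cases c
  · simp only [Bool.false_eq_true, if_false, zero_mul, zero_add, sub_zero, one_mul]
    exact sum_congr rfl fun j _ => by cases b j <;> simp [boolDist]
  · simp only [if_true, one_mul, sub_self, zero_mul, add_zero]
    rw [eq_sub_iff_add_eq, ← sum_add_distrib]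
    calc _ = ∑ _j : ι, (1 : ℝ) := sum_congr rfl fun j _ => by cases b j <;> simp [boolDist]
      _ = _ := by simp

theorem sum_sum_boolDist {ι κ : Type} [Fintype ι] [Fintype κ] (a : ι → Bool) (b : κ → Bool) :
    ∑ i, ∑ j, boolDist (a i) (b j) =
      (∑ i, if a i then (1 : ℝ) else 0) * (Fintype.card κ - ∑ j, if b j then (1 : ℝ) else 0)
      + (Fintype.card ι - ∑ i, if a i then (1 : ℝ) else 0) * ∑ j, if b j then (1 : ℝ) else 0 := by
  simp only [sum_boolDist_left, sum_add_distrib, ← sum_mul, sum_sub_distrib, sum_const, card_univ,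
    nsmul_eq_mul, mul_one]

theorem sum_ordPair_boolDist {t : ℕ} (b : Fin t → Bool) :
    ∑ q : OrdPair t, boolDist (b q.1.1) (b q.1.2) =
      (∑ j, if b j then (1 : ℝ) else 0) * (t - ∑ j, if b j then (1 : ℝ) else 0) := by
  have h1 := sum_sum_boolDist b b
  have h2 : ∑ i, ∑ j, boolDist (b i) (b j) =
      (∑ i, ∑ j, if i < j then boolDist (b i) (b j) else 0) +
      ∑ i, ∑ j, if j < i then boolDist (b j) (b i) else 0 := by
    rw [← sum_add_distrib]
    refine sum_congr rfl fun i _ => ?_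
    rw [← sum_add_distrib]
    refine sum_congr rfl fun j _ => ?_
    rcases lt_trichotomy i j with h | rfl | h
    · rw [if_pos h, if_neg h.asymm, add_zero]
    · simp [boolDist_self]
    · rw [if_pos h, if_neg h.asymm, zero_add, boolDist_comm]
  rw [sum_comm (f := fun i j => if j < i then boolDist (b j) (b i) else 0), h1] at h2
  rw [sum_ordPair fun i j => boolDist (b i) (b j)]
  rw [Fintype.card_fin] at h2
  linarith

theorem cliqueWebValue_extendFalse (t r : ℕ) (a : Fin (t + 2 * r) → Bool) (b : Fin t → Bool) :
    cliqueWebValue r t (extendFalse a) (∑ j, if b j then (1 : ℝ) else 0) =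
      ∑ i, (if r ≤ i.val ∧ i.val + r < t + 2 * r then 1 else 0) * boolDist (a i) false
      - ∑ j, boolDist (b j) false - ∑ i, ∑ j, boolDist (a i) (b j)
      + ∑ p : OrdPair (t + 2 * r), webInd r p * boolDist (a p.1.1) (a p.1.2)
      + ∑ q : OrdPair t, boolDist (b q.1.1) (b q.1.2) := by
  unfold cliqueWebValue
  have hb : ∑ j, boolDist (b j) false = ∑ j, if b j then (1 : ℝ) else 0 :=
    sum_congr rfl fun j _ => by cases b j <;> simp [boolDist]
  rw [show r + (t + 1) + r = t + 2 * r + 1 by ring, webCut_extendFalse (by omega),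
    trueCount_extendFalse, sum_ordPair_boolDist, sum_sum_boolDist, hb]
  simp only [Fintype.card_fin]
  push_cast
  ring

theorem cutOfCorr_classicalPoint_a {α β : Type} (f : α → Bool) (g : β → Bool) (i : α) :
    cutOfCorr (classicalPoint f g) (.a i) = boolDist (f i) false := by
  cases h : f i <;> simp [cutOfCorr, classicalPoint, boolDist, h]

theorem cutOfCorr_classicalPoint_b {α β : Type} (f : α → Bool) (g : β → Bool) (j : β) :
    cutOfCorr (classicalPoint f g) (.b j) = boolDist (g j) false := by
  cases h : g j <;> simp [cutOfCorr, classicalPoint, boolDist, h]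

theorem cutOfCorr_classicalPoint_ab {α β : Type} (f : α → Bool) (g : β → Bool) (i : α) (j : β) :
    cutOfCorr (classicalPoint f g) (.ab i j) = boolDist (f i) (g j) := by
  cases h : f i <;> cases h' : g j <;> norm_num [cutOfCorr, classicalPoint, boolDist, h, h']

section ClassicalValue

variable {t r : ℕ} (f : AliceObs (t + 2 * r) t → Bool) (g : BobObs (t + 2 * r) t → Bool)

theorem linForm_pureCliqueWebBell_classicalPoint (ht : 0 < t) :
    2 * linForm (pureCliqueWebBell (t + 2 * r) t r) (classicalPoint f g) =
      ∑ i : Fin (t + 2 * r), (if r ≤ i.val ∧ i.val + r < t + 2 * r then 1 else 0) *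
        boolDist (f (.inl i)) false
      - ∑ j, boolDist (g (.inl j)) false - ∑ i, ∑ j, boolDist (f (.inl i)) (g (.inl j))
      + ∑ p : OrdPair (t + 2 * r), webInd r p *
        (boolDist (f (.inl p.1.1)) (g (.inr p)) - boolDist (f (.inl p.1.2)) (g (.inr p)))
      + ∑ q : OrdPair t,
        (boolDist (f (.inr q)) (g (.inl q.1.1)) - boolDist (f (.inr q)) (g (.inl q.1.2))) := by
  rw [← linForm_triangularElimination_cutOfCorr t r ht,
    linForm_triangularElimination (by omega)]
  simp only [cutOfCorr_classicalPoint_a, cutOfCorr_classicalPoint_b, cutOfCorr_classicalPoint_ab]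

theorem linForm_pureCliqueWebBell_classicalPoint_nonpos (ht : 0 < t) :
    linForm (pureCliqueWebBell (t + 2 * r) t r) (classicalPoint f g) ≤ 0 := by
  have h1 := linForm_pureCliqueWebBell_classicalPoint f g ht
  have h2 := cliqueWebValue_extendFalse t r (fun i => f (.inl i)) (fun j => g (.inl j))
  rw [sum_boole] at h2
  have h3 := cliqueWebValue_nonpos r t (extendFalse fun i => f (.inl i))
    (#{j | g (.inl j)}) ((card_le_univ _).trans_eq (Fintype.card_fin t))
  have h4 : ∑ p : OrdPair (t + 2 * r), webInd r p *
      (boolDist (f (.inl p.1.1)) (g (.inr p)) - boolDist (f (.inl p.1.2)) (g (.inr p))) ≤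
      ∑ p : OrdPair (t + 2 * r), webInd r p * boolDist (f (.inl p.1.1)) (f (.inl p.1.2)) :=
    sum_le_sum fun p _ => mul_le_mul_of_nonneg_left (by
      have := boolDist_triangle (f (.inl p.1.1)) (g (.inr p)) (f (.inl p.1.2))
      rw [boolDist_comm (g _)] at this
      linarith) (webInd_nonneg p)
  have h5 : ∑ q : OrdPair t,
      (boolDist (f (.inr q)) (g (.inl q.1.1)) - boolDist (f (.inr q)) (g (.inl q.1.2))) ≤
      ∑ q : OrdPair t, boolDist (g (.inl q.1.1)) (g (.inl q.1.2)) :=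
    sum_le_sum fun q _ => by
      have := boolDist_triangle (g (.inl q.1.1)) (f (.inr q)) (g (.inl q.1.2))
      rw [boolDist_comm _ (f _), boolDist_comm (f _) (g (.inl q.1.2)),
        boolDist_comm (g (.inl q.1.2)) (f _)] at this
      linarith
  linarith

/-- The classical configurations that are roots of `pureCliqueWebBell` because `A_1, …, A_s`
are labelled by an interval and the new observables are chosen optimally. -/
theorem linForm_pureCliqueWebBell_classicalPoint_eq_zero (ht : 0 < t) {u m : ℕ}
    {T : Finset (Fin t)} (hum : u + m ≤ t + 2 * r) (hm : m ≤ t + r + 1)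
    (hT : m ≤ r + 1 ∧ #T = 0 ∨ m = r + #T ∨ m = r + 1 + #T)
    (hf : ∀ i, f (.inl i) = intervalInd u m i) (hg : ∀ j, g (.inl j) = decide (j ∈ T))
    (hA : ∀ p : OrdPair (t + 2 * r), webInd r p ≠ 0 → f (.inl p.1.1) ≠ f (.inl p.1.2) →
      g (.inr p) = f (.inl p.1.2))
    (hB : ∀ q : OrdPair t, g (.inl q.1.1) ≠ g (.inl q.1.2) → f (.inr q) = g (.inl q.1.2)) :
    linForm (pureCliqueWebBell (t + 2 * r) t r) (classicalPoint f g) = 0 := by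
  have h1 := linForm_pureCliqueWebBell_classicalPoint f g ht
  have h2 := cliqueWebValue_extendFalse t r (fun i => f (.inl i)) (fun j => g (.inl j))
  have hy : ∑ j, (if g (.inl j) then (1 : ℝ) else 0) = #T := by
    simp [hg]
  have hext : ∀ k < r + (t + 1) + r, extendFalse (fun i => f (.inl i)) k = intervalInd u m k := by
    intro k hk
    unfold extendFalse
    split_ifs with h
    · exact hf ⟨k, h⟩
    -- The remaining index is that of `X`; `hum` keeps the interval away from it.
    · simp only [intervalInd]
      rw [eq_comm, decide_eq_false_iff_not]
      omega
  have h3 := cliqueWebValue_interval (r := r) (q := t) (u := u) (by omega) (by omega) hT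
  rw [hy] at h2
  have h3' : cliqueWebValue r t (extendFalse fun i => f (.inl i)) #T = 0 := by
    rw [← h3]
    unfold cliqueWebValue
    rw [webCut_congr hext, show trueCount _ _ = trueCount (r + (t + 1) + r) (intervalInd u m) from
      sum_congr rfl fun k hk => by rw [hext k (mem_range.1 hk)]]
  have h4 : ∑ p : OrdPair (t + 2 * r), webInd r p *
      (boolDist (f (.inl p.1.1)) (g (.inr p)) - boolDist (f (.inl p.1.2)) (g (.inr p))) =
      ∑ p : OrdPair (t + 2 * r), webInd r p * boolDist (f (.inl p.1.1)) (f (.inl p.1.2)) :=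
    sum_congr rfl fun p _ => by
      by_cases hw : webInd r p = 0
      · rw [hw, zero_mul, zero_mul]
      · by_cases hne : f (.inl p.1.1) = f (.inl p.1.2)
        · rw [hne, sub_self, boolDist_self]
        · rw [hA p hw hne, boolDist_self, sub_zero]
  have h5 : ∑ q : OrdPair t,
      (boolDist (f (.inr q)) (g (.inl q.1.1)) - boolDist (f (.inr q)) (g (.inl q.1.2))) =
      ∑ q : OrdPair t, boolDist (g (.inl q.1.1)) (g (.inl q.1.2)) :=
    sum_congr rfl fun q _ => by
      by_cases hne : g (.inl q.1.1) = g (.inl q.1.2)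
      · rw [hne, sub_self, boolDist_self]
      · rw [hB q hne, boolDist_self, sub_zero, boolDist_comm]
  linarith

end ClassicalValue

/-! ### Flipping one observable -/

section Marginals

variable {α β : Type} [Fintype α] [Fintype β] (d : BellCoord α β → ℝ)

theorem linForm_classicalPoint (f : α → Bool) (g : β → Bool) :
    linForm d (classicalPoint f g) = ∑ i, (if f i then d (.a i) else 0) +
      ∑ j, (if g j then d (.b j) + ∑ i, (if f i then d (.ab i j) else 0) else 0) := by
  rw [linForm_bellCoord, sum_comm, ← sum_add_distrib]
  congr 1
  · exact sum_congr rfl fun i _ => by cases h : f i <;> simp [classicalPoint, h]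
  · refine sum_congr rfl fun j _ => ?_
    cases h : g j
    · simp [classicalPoint, h]
    · rw [if_pos rfl]
      congr 1
      · simp [classicalPoint, h]
      · exact sum_congr rfl fun i _ => by cases h' : f i <;> simp [classicalPoint, h, h']

theorem linForm_classicalPoint' (f : α → Bool) (g : β → Bool) :
    linForm d (classicalPoint f g) = ∑ j, (if g j then d (.b j) else 0) +
      ∑ i, (if f i then d (.a i) + ∑ j, (if g j then d (.ab i j) else 0) else 0) := by
  rw [linForm_bellCoord, ← add_assoc, add_comm (∑ i, _) (∑ j, _), add_assoc, ← sum_add_distrib]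
  congr 1
  · exact sum_congr rfl fun j _ => by cases h : g j <;> simp [classicalPoint, h]
  · refine sum_congr rfl fun i _ => ?_
    cases h : f i
    · simp [classicalPoint, h]
    · rw [if_pos rfl]
      congr 1
      · simp [classicalPoint, h]
      · exact sum_congr rfl fun j _ => by cases h' : g j <;> simp [classicalPoint, h, h']

/-- The alternative `h i = 0` allows for further changes at observables whose joint coefficient is
already known to vanish. -/
theorem sum_ite_eq_add_of_insert {ι : Type} [Fintype ι] {a b : ι → Bool} {x : ι} (h : ι → ℝ)
    (ha : a x = false) (hb : b x = true) (hab : ∀ i ≠ x, b i = a i ∨ h i = 0) :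
    ∑ i, (if b i then h i else 0) = ∑ i, (if a i then h i else 0) + h x := by
  classical
  rw [← sum_erase_add _ _ (mem_univ x), ← sum_erase_add univ (fun i => if a i then h i else 0)
    (mem_univ x), hb, ha, if_pos rfl, if_neg Bool.false_ne_true, add_zero]
  congr 1
  refine sum_congr rfl fun i hi => ?_
  rcases hab i (ne_of_mem_erase hi) with h | h
  · rw [h]
  · rw [h, ite_self, ite_self]

/-- If flipping Bob's observable `x` does not change `dᵀ q = 0`, then its coefficient, given
Alice's values, vanishes. -/
theorem marginal_bob_eq_zero {f : α → Bool} {g g' : β → Bool} {x : β} (hg : g x = false)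
    (hg' : g' x = true) (h : ∀ j ≠ x, g' j = g j) (h0 : linForm d (classicalPoint f g) = 0)
    (h1 : linForm d (classicalPoint f g') = 0) :
    d (.b x) + ∑ i, (if f i then d (.ab i x) else 0) = 0 := by
  rw [linForm_classicalPoint] at h0 h1
  rw [sum_ite_eq_add_of_insert _ hg hg' fun i hi => .inl (h i hi)] at h1
  linarith

theorem marginal_alice_eq_zero {f f' : α → Bool} {g : β → Bool} {x : α} (hf : f x = false)
    (hf' : f' x = true) (h : ∀ i ≠ x, f' i = f i) (h0 : linForm d (classicalPoint f g) = 0)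
    (h1 : linForm d (classicalPoint f' g) = 0) :
    d (.a x) + ∑ j, (if g j then d (.ab x j) else 0) = 0 := by
  rw [linForm_classicalPoint'] at h0 h1
  rw [sum_ite_eq_add_of_insert _ hf hf' fun i hi => .inl (h i hi)] at h1
  linarith

end Marginals

/-! ### Coefficients at the new observables -/

section Facet

variable {t r : ℕ} {d : BellCoord (AliceObs (t + 2 * r) t) (BobObs (t + 2 * r) t) → ℝ}

/-- `dᵀ q` vanishes on the classical configurations on the face of `pureCliqueWebBell`. -/
def VanishesOnRoots (d : BellCoord (AliceObs (t + 2 * r) t) (BobObs (t + 2 * r) t) → ℝ) : Prop :=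
  ∀ f g, linForm (pureCliqueWebBell (t + 2 * r) t r) (classicalPoint f g) = 0 →
    linForm d (classicalPoint f g) = 0

namespace VanishesOnRoots

theorem eq_zero_of_empty (hd : VanishesOnRoots d) (ht : 0 < t)
    (a' : OrdPair t → Bool) (b' : OrdPair (t + 2 * r) → Bool) :
    linForm d (classicalPoint (Sum.elim (fun _ => false) a') (Sum.elim (fun _ => false) b')) = 0 :=
  hd _ _ <| linForm_pureCliqueWebBell_classicalPoint_eq_zero (u := 0) (m := 0) (T := ∅) _ _ ht
    (by omega) (by omega) (by simp) (fun i => by simp [intervalInd]) (fun j => by simp)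
    (fun p _ h => absurd rfl h) (fun q h => absurd rfl h)

/-- When all `A_i` and `B_j` are false, every new observable is free. -/
theorem bob_primed_marginal_empty (hd : VanishesOnRoots d) (ht : 0 < t)
    (p : OrdPair (t + 2 * r)) (a' : OrdPair t → Bool) :
    d (.b (.inr p)) + ∑ q, (if a' q then d (.ab (.inr q) (.inr p)) else 0) = 0 := by
  have := marginal_bob_eq_zero d (x := .inr p) (by simp) (by simp) ?_
    (hd.eq_zero_of_empty ht a' (fun _ => false))
    (hd.eq_zero_of_empty ht a' (fun p' => decide (p' = p)))
  · rw [Fintype.sum_sum_type] at this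
    simp only [Sum.elim_inl, Sum.elim_inr, Bool.false_eq_true, if_false, sum_const_zero,
      zero_add] at this
    exact this
  · rintro (j | j) hj
    · rfl
    · simpa using hj

theorem bob_primed (hd : VanishesOnRoots d) (ht : 0 < t) (p : OrdPair (t + 2 * r)) :
    d (.b (.inr p)) = 0 := by
  simpa using hd.bob_primed_marginal_empty ht p fun _ => false

theorem primed_primed (hd : VanishesOnRoots d) (ht : 0 < t) (p : OrdPair (t + 2 * r))
    (q : OrdPair t) : d (.ab (.inr q) (.inr p)) = 0 := by
  simpa [hd.bob_primed ht p] using hd.bob_primed_marginal_empty ht p fun q' => decide (q' = q)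

theorem alice_primed (hd : VanishesOnRoots d) (ht : 0 < t) (q : OrdPair t) :
    d (.a (.inr q)) = 0 := by
  have := marginal_alice_eq_zero d (x := .inr q) (by simp) (by simp) ?_
    (hd.eq_zero_of_empty ht (fun _ => false) (fun _ => false))
    (hd.eq_zero_of_empty ht (fun q' => decide (q' = q)) (fun _ => false))
  · simpa [Fintype.sum_sum_type] using this
  · rintro (j | j) hj
    · rfl
    · simpa using hj

/-- The marginal of a new observable of Bob at an interval where its value is free. -/
theorem sum_bob_primed (hd : VanishesOnRoots d) (ht : 0 < t) {u m : ℕ} {T : Finset (Fin t)}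
    (hum : u + m ≤ t + 2 * r) (hm : m ≤ t + r + 1)
    (hT : m ≤ r + 1 ∧ #T = 0 ∨ m = r + #T ∨ m = r + 1 + #T) (p : OrdPair (t + 2 * r))
    (hp : webInd r p = 0 ∨ intervalInd u m p.1.1 = intervalInd u m p.1.2) :
    ∑ i : Fin (t + 2 * r), (if intervalInd u m i then d (.ab (.inl i) (.inr p)) else 0) = 0 := by
  classical
  have key : ∀ c : Bool, linForm d (classicalPoint
      (Sum.elim (fun i : Fin (t + 2 * r) => intervalInd u m i) fun q => decide (q.1.2 ∈ T))
      (Sum.elim (fun j => decide (j ∈ T)) fun p' => if p' = p then c else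
        intervalInd u m p'.1.2)) = 0 := fun c =>
    hd _ _ <| linForm_pureCliqueWebBell_classicalPoint_eq_zero (u := u) (m := m) (T := T) _ _ ht
      hum hm hT (fun i => rfl) (fun j => rfl) (fun p' hw h => by
        simp only [Sum.elim_inl, Sum.elim_inr] at h ⊢
        rw [if_neg]
        rintro rfl
        exact hp.elim hw h) (fun q _ => rfl)
  have := marginal_bob_eq_zero d (x := .inr p) (by simp) (by simp) ?_ (key false) (key true)
  · rw [Fintype.sum_sum_type] at this
    simp only [Sum.elim_inl, Sum.elim_inr, hd.bob_primed ht, hd.primed_primed ht, ite_self,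
      sum_const_zero, zero_add, add_zero] at this
    exact this
  · rintro (j | j) hj
    · rfl
    · have : j ≠ p := by simpa using hj
      simp [this]

theorem sum_alice_primed (hd : VanishesOnRoots d) (ht : 0 < t) {u m : ℕ} {T : Finset (Fin t)}
    (hum : u + m ≤ t + 2 * r) (hm : m ≤ t + r + 1)
    (hT : m ≤ r + 1 ∧ #T = 0 ∨ m = r + #T ∨ m = r + 1 + #T) (q : OrdPair t)
    (hq : q.1.1 ∈ T ↔ q.1.2 ∈ T) : ∑ j ∈ T, d (.ab (.inr q) (.inl j)) = 0 := by
  classical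
  have key : ∀ c : Bool, linForm d (classicalPoint
      (Sum.elim (fun i : Fin (t + 2 * r) => intervalInd u m i) fun q' => if q' = q then c else
        decide (q'.1.2 ∈ T))
      (Sum.elim (fun j => decide (j ∈ T)) fun p => intervalInd u m p.1.2)) = 0 := fun c =>
    hd _ _ <| linForm_pureCliqueWebBell_classicalPoint_eq_zero (u := u) (m := m) (T := T) _ _ ht
      hum hm hT (fun i => rfl) (fun j => rfl) (fun p _ _ => rfl) (fun q' h => by
        simp only [Sum.elim_inl, Sum.elim_inr] at h ⊢
        rw [if_neg]
        rintro rfl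
        exact h (by simp [hq]))
  have := marginal_alice_eq_zero d (x := .inr q) (by simp) (by simp) ?_ (key false) (key true)
  · simpa [Fintype.sum_sum_type, hd.alice_primed ht, hd.primed_primed ht, sum_ite_mem] using this
  · rintro (j | j) hj
    · rfl
    · have : j ≠ q := by simpa using hj
      simp [this]

/-- At the interval `{i}` with `T` empty the new observable is free, and its marginal is this single
coefficient. -/
theorem bob_primed_eq_zero (hd : VanishesOnRoots d) (ht : 0 < t) (p : OrdPair (t + 2 * r))
    (i : Fin (t + 2 * r)) (h : webInd r p = 0 ∨ i ≠ p.1.1 ∧ i ≠ p.1.2) :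
    d (.ab (.inl i) (.inr p)) = 0 := by
  have hI : ∀ k : Fin (t + 2 * r), intervalInd i 1 k = decide (k = i) := fun k => by
    simp only [intervalInd, decide_eq_decide, Fin.ext_iff]; omega
  have := hd.sum_bob_primed ht (u := i) (m := 1) (T := ∅) (by omega) (by omega) (by simp) p
    (h.imp_right fun h => by simp [hI, h.1.symm, h.2.symm])
  simpa [hI] using this

theorem bob_primed_fst (hd : VanishesOnRoots d) (ht : 0 < t) (p : OrdPair (t + 2 * r)) :
    d (.ab (.inl p.1.1) (.inr p)) = -d (.ab (.inl p.1.2) (.inr p)) := by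
  by_cases hw : webInd r p = 0
  · rw [hd.bob_primed_eq_zero ht p _ (.inl hw), hd.bob_primed_eq_zero ht p _ (.inl hw), neg_zero]
  have hp : p.1.1.val < p.1.2.val := p.2
  have hw' : r + 1 ≤ p.1.2.val - p.1.1.val ∧ p.1.2.val - p.1.1.val ≤ t + 2 * r - r := by
    by_contra h
    exact hw (if_neg h)
  -- The closed interval from `p.1.1` to `p.1.2` then has length `r + 1 + #T`; the web condition
  -- gives `#T ≤ t`.
  obtain ⟨T, -, hT⟩ := exists_subset_card_eq (s := (univ : Finset (Fin t)))
    (n := p.1.2.val - p.1.1.val - r) (by rw [card_univ, Fintype.card_fin]; omega)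
  have h1 : intervalInd p.1.1 (p.1.2.val - p.1.1.val + 1) p.1.1 = true := by
    simp only [intervalInd, decide_eq_true_eq]; omega
  have h2 : intervalInd p.1.1 (p.1.2.val - p.1.1.val + 1) p.1.2 = true := by
    simp only [intervalInd, decide_eq_true_eq]; omega
  have := hd.sum_bob_primed ht (u := p.1.1) (m := p.1.2.val - p.1.1.val + 1) (T := T)
    (by omega) (by omega) (by omega) p (.inr (h1.trans h2.symm))
  rw [Fintype.sum_eq_add p.1.1 p.1.2 (by exact p.2.ne) fun i hi => by
    rw [hd.bob_primed_eq_zero ht p i (.inr hi), ite_self], h1, h2, if_pos rfl, if_pos rfl] at this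
  linarith

theorem alice_primed_eq_zero (hd : VanishesOnRoots d) (ht : 2 ≤ t) (q : OrdPair t)
    (j : Fin t) (h : j ≠ q.1.1 ∧ j ≠ q.1.2) : d (.ab (.inr q) (.inl j)) = 0 := by
  simpa using hd.sum_alice_primed (by omega) (u := 0) (m := r + 1) (T := {j}) (by omega) (by omega)
    (by simp) q (by simp [h.1.symm, h.2.symm])

theorem alice_primed_fst (hd : VanishesOnRoots d) (ht : 2 ≤ t) (q : OrdPair t) :
    d (.ab (.inr q) (.inl q.1.1)) = -d (.ab (.inr q) (.inl q.1.2)) := by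
  have hc : #{q.1.1, q.1.2} = 2 := card_pair q.2.ne
  have := hd.sum_alice_primed (by omega) (u := 0) (m := r + 2) (T := {q.1.1, q.1.2}) (by omega)
    (by omega) (by omega) q (by simp)
  rw [sum_pair q.2.ne] at this
  linarith

end VanishesOnRoots

end Facet

/-! ### Joint coefficients of the original observables and uniqueness of the form -/

section Facet

variable {t r : ℕ} {d : BellCoord (AliceObs (t + 2 * r) t) (BobObs (t + 2 * r) t) → ℝ}

namespace VanishesOnRoots

/-- The marginal of `B_j` at an interval and `T ∌ j`. -/
theorem marginal_bob (hd : VanishesOnRoots d) (ht : 0 < t) {u m : ℕ} {T : Finset (Fin t)}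
    (hum : u + m ≤ t + 2 * r) (hm : m ≤ t + r + 1) (hT : m = r + 1 + #T) {j : Fin t}
    (hj : j ∉ T) :
    d (.b (.inl j)) + (∑ i : Fin (t + 2 * r),
      (if intervalInd u m i then d (.ab (.inl i) (.inl j)) else 0) +
      ∑ q : OrdPair t, if (if q.1.2 = j then !decide (q.1.1 ∈ T) else decide (q.1.2 ∈ T))
        then d (.ab (.inr q) (.inl j)) else 0) = 0 := by
  -- One choice of Alice's new observables must serve both `T` and `insert j T`. If `q.1.2 = j`, the
  -- value matters only when it has to differ from that of `B_{q.1.1}`, so the negation of the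
  -- latter works both times.
  have key : ∀ T' : Finset (Fin t), (m = r + #T' ∨ m = r + 1 + #T') →
      (∀ k ≠ j, k ∈ T' ↔ k ∈ T) → linForm d (classicalPoint
      (Sum.elim (fun i : Fin (t + 2 * r) => intervalInd u m i) fun q =>
        if q.1.2 = j then !decide (q.1.1 ∈ T) else decide (q.1.2 ∈ T))
      (Sum.elim (fun k => decide (k ∈ T')) fun p => intervalInd u m p.1.2)) = 0 :=
    fun T' hT' hTT' =>
    hd _ _ <| linForm_pureCliqueWebBell_classicalPoint_eq_zero (u := u) (m := m) (T := T') _ _ ht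
      hum hm (.inr hT') (fun i => rfl) (fun j => rfl) (fun p _ _ => rfl) (fun q h => by
        simp only [Sum.elim_inl, Sum.elim_inr] at h ⊢
        by_cases hq : q.1.2 = j
        · rw [if_pos hq]
          have := hTT' q.1.1 (hq ▸ q.2.ne)
          by_cases h1 : q.1.1 ∈ T' <;> by_cases h2 : q.1.2 ∈ T' <;> simp_all
        · rw [if_neg hq, decide_eq_decide, hTT' _ hq])
  have := marginal_bob_eq_zero d (x := .inl j) (by simpa using hj) (by simp) ?_
    (key T (.inr hT) fun _ _ => Iff.rfl)
    (key (insert j T) (.inl (by rw [card_insert_of_notMem hj]; omega))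
      fun k hk => by simp [hk])
  · rw [Fintype.sum_sum_type] at this
    exact this
  · rintro (k | k) hk
    · have : k ≠ j := by simpa using hk
      simp [this]
    · rfl

/-- Counterpart of `marginal_bob`: `T` is fixed and the interval grows by `x`, from length `r + #T`
to `r + 1 + #T`. -/
theorem marginal_alice (hd : VanishesOnRoots d) (ht : 0 < t) {u m u' m' : ℕ}
    {T : Finset (Fin t)} (hum : u + m ≤ t + 2 * r) (hum' : u' + m' ≤ t + 2 * r)
    (hm' : m' ≤ t + r + 1) (hmm' : m' = m + 1) (hT : m = r + #T) {x : Fin (t + 2 * r)}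
    (hx : intervalInd u m x = false) (hx' : intervalInd u' m' x = true)
    (h : ∀ i ≠ x, intervalInd u' m' i = intervalInd u m i) :
    d (.a (.inl x)) + (∑ j, (if decide (j ∈ T) then d (.ab (.inl x) (.inl j)) else 0) +
      ∑ p : OrdPair (t + 2 * r), if (if p.1.2 = x then !intervalInd u m p.1.1
        else intervalInd u m p.1.2) then d (.ab (.inl x) (.inr p)) else 0) = 0 := by
  have key : ∀ u₁ m₁ : ℕ, u₁ + m₁ ≤ t + 2 * r → m₁ ≤ t + r + 1 →
      (m₁ = r + #T ∨ m₁ = r + 1 + #T) →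
      (∀ i ≠ x, intervalInd u₁ m₁ i = intervalInd u m i) → linForm d (classicalPoint
      (Sum.elim (fun i : Fin (t + 2 * r) => intervalInd u₁ m₁ i) fun q => decide (q.1.2 ∈ T))
      (Sum.elim (fun k => decide (k ∈ T)) fun p =>
        if p.1.2 = x then !intervalInd u m p.1.1 else intervalInd u m p.1.2)) = 0 :=
    fun u₁ m₁ hum hm hT hI =>
    hd _ _ <| linForm_pureCliqueWebBell_classicalPoint_eq_zero (u := u₁) (m := m₁) (T := T) _ _ ht
      hum hm (.inr hT) (fun i => rfl) (fun j => rfl) (fun p _ h => by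
        simp only [Sum.elim_inl, Sum.elim_inr] at h ⊢
        by_cases hp : p.1.2 = x
        · rw [if_pos hp, ← hI p.1.1 (hp ▸ p.2.ne)]
          exact (Bool.eq_not_of_ne h.symm).symm
        · rw [if_neg hp, hI _ hp]) (fun q _ => rfl)
  have := marginal_alice_eq_zero d (x := .inl x) hx hx' ?_
    (key u m hum (by omega) (.inl hT) fun _ _ => rfl) (key u' m' hum' hm' (.inr (by omega)) h)
  · rw [Fintype.sum_sum_type] at this
    exact this
  · rintro (k | k) hk
    · exact h k (by simpa using hk)
    · rfl

/-- All coefficients `A_x B_j` agree with those at the new observables of Alice. -/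
theorem ab_eq_alice_primed (hd : VanishesOnRoots d) (ht : 2 ≤ t) (q : OrdPair t) {j k : Fin t}
    (hjk : j = q.1.1 ∧ k = q.1.2 ∨ j = q.1.2 ∧ k = q.1.1) (x : Fin (t + 2 * r)) :
    d (.ab (.inl x) (.inl j)) = d (.ab (.inr q) (.inl q.1.2)) := by
  have hlt : q.1.1 < q.1.2 := q.2
  -- The short interval ends just before `x` or, near the left end, starts just after it; `2 ≤ t`
  -- leaves room for that.
  obtain ⟨u₁, u₂, h1, h2, hx, hx', hI⟩ : ∃ u₁ u₂ : ℕ, u₁ + (r + 1) ≤ t + 2 * r ∧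
      u₂ + (r + 2) ≤ t + 2 * r ∧ intervalInd u₁ (r + 1) x = false ∧
      intervalInd u₂ (r + 2) x = true ∧ ∀ i : Fin (t + 2 * r), i ≠ x →
      intervalInd u₂ (r + 2) i = intervalInd u₁ (r + 1) i := by
    have hx := x.2
    by_cases h : r + 1 ≤ x.val
    · refine ⟨x - (r + 1), x - (r + 1), by omega, by omega, ?_, ?_, fun i hi => ?_⟩
      · simp only [intervalInd, decide_eq_false_iff_not]; omega
      · simp only [intervalInd, decide_eq_true_eq]; omega
      · simp only [intervalInd, decide_eq_decide]; omega
    · refine ⟨x + 1, x, by omega, by omega, ?_, ?_, fun i hi => ?_⟩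
      · simp only [intervalInd, decide_eq_false_iff_not]; omega
      · simp only [intervalInd, decide_eq_true_eq]; omega
      · simp only [intervalInd, decide_eq_decide]; omega
  have hjk' : j ≠ k := by
    rcases hjk with ⟨rfl, rfl⟩ | ⟨rfl, rfl⟩
    · exact hlt.ne
    · exact hlt.ne'
  -- Two marginals of `B_j`: `k` joins `T` while `x` joins the interval, so they differ only by the
  -- terms of `A_x` and `A'_q`.
  have e1 := hd.marginal_bob (by omega) (T := ∅) h1 (by omega) (by simp) (notMem_empty j)
  have e2 := hd.marginal_bob (by omega) (T := {k}) h2 (by omega) (by simp)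
    (by simpa using hjk')
  rw [sum_ite_eq_add_of_insert (a := fun i : Fin (t + 2 * r) => intervalInd u₁ (r + 1) i)
    (b := fun i : Fin (t + 2 * r) => intervalInd u₂ (r + 2) i) _ hx hx'
    fun i hi => .inl (hI i hi)] at e2
  have hq : ∀ q' : OrdPair t, q' ≠ q → (if q'.1.2 = j then !decide (q'.1.1 ∈ ({k} : Finset _))
      else decide (q'.1.2 ∈ ({k} : Finset _))) =
      (if q'.1.2 = j then !decide (q'.1.1 ∈ (∅ : Finset (Fin t)))
        else decide (q'.1.2 ∈ (∅ : Finset (Fin t)))) ∨ d (.ab (.inr q') (.inl j)) = 0 := by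
    intro q' hq'
    have hlt' : q'.1.1 < q'.1.2 := q'.2
    by_cases hj2 : q'.1.2 = j
    · left
      have : q'.1.1 ≠ k := by
        rintro rfl
        rcases hjk with ⟨h, h'⟩ | ⟨h, h'⟩
        · exact absurd hlt (by rw [← h, ← h', ← hj2]; exact hlt'.asymm)
        · exact hq' (Subtype.ext (Prod.ext h' (hj2.trans h)))
      simp [hj2, this]
    · by_cases hj1 : j = q'.1.1
      · left
        have : q'.1.2 ≠ k := by
          rintro rfl
          rcases hjk with ⟨h, h'⟩ | ⟨h, h'⟩
          · exact hq' (Subtype.ext (Prod.ext (hj1.symm.trans h) h'))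
          · exact absurd hlt (by rw [← h, ← h', hj1]; exact hlt'.asymm)
        simp [hj2, this]
      · right
        exact hd.alice_primed_eq_zero ht q' j ⟨hj1, fun h => hj2 h.symm⟩
  -- `A'_q` turns from false to true if `j = q.1.1`, and from true to false if `j = q.1.2`.
  rcases hjk with ⟨rfl, rfl⟩ | ⟨rfl, rfl⟩
  · rw [sum_ite_eq_add_of_insert (x := q) (fun q' => d (.ab (.inr q') (.inl q.1.1)))
      (by simp [hlt.ne']) (by simp [hlt.ne']) hq, hd.alice_primed_fst ht] at e2
    linarith
  · rw [sum_ite_eq_add_of_insert (x := q) (fun q' => d (.ab (.inr q') (.inl q.1.2)))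
      (by simp) (by simp) fun q' hq' => (hq q' hq').imp_left Eq.symm] at e1
    linarith

/-- All coefficients `A_x B_j` agree with those at the new observables of Bob. -/
theorem ab_eq_bob_primed (hd : VanishesOnRoots d) (ht : 0 < t) (p : OrdPair (t + 2 * r))
    (hp : webInd r p ≠ 0) : ∃ j, d (.ab (.inl p.1.2) (.inl j)) = d (.ab (.inl p.1.2) (.inr p)) := by
  have hlt : p.1.1.val < p.1.2.val := p.2
  have hw : r + 1 ≤ p.1.2.val - p.1.1.val ∧ p.1.2.val - p.1.1.val ≤ t + 2 * r - r := by
    by_contra h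
    exact hp (if_neg h)
  have hx2 := p.1.2.2
  -- The open interval between `p.1.1` and `p.1.2` has length `r + #T`, and `#T < t` leaves some `j`
  -- outside `T`.
  obtain ⟨T, -, hT⟩ := exists_subset_card_eq (s := (univ : Finset (Fin t)))
    (n := p.1.2.val - p.1.1.val - (r + 1)) (by rw [card_univ, Fintype.card_fin]; omega)
  obtain ⟨j, -, hj⟩ : ∃ j ∈ (univ : Finset (Fin t)), j ∉ T :=
    exists_mem_notMem_of_card_lt_card (by rw [card_univ, Fintype.card_fin]; omega)
  refine ⟨j, ?_⟩
  have hx : ∀ u m, u + m = p.1.2.val → intervalInd u m p.1.2 = false ∧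
      intervalInd u (m + 1) p.1.2 = true ∧
      ∀ i : Fin (t + 2 * r), i ≠ p.1.2 → intervalInd u (m + 1) i = intervalInd u m i := by
    intro u m hum
    refine ⟨?_, ?_, fun i hi => ?_⟩
    · simp only [intervalInd, decide_eq_false_iff_not]; omega
    · simp only [intervalInd, decide_eq_true_eq]; omega
    · simp only [intervalInd, decide_eq_decide]; omega
  obtain ⟨h1, h2, h3⟩ := hx (p.1.1 + 1) (p.1.2 - p.1.1 - 1) (by omega)
  obtain ⟨h1', h2', h3'⟩ := hx p.1.1 (p.1.2 - p.1.1) (by omega)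
  -- Two marginals of `A_{p.1.2}`: `p.1.1` joins the interval while `j` joins `T`. Then `B'_p` turns
  -- from true to false, so `e1` has its term and `e2` has that of `B_j`.
  have e1 := hd.marginal_alice ht (T := T) (by omega) (by omega) (by omega) rfl (by omega) h1 h2 h3
  have e2 := hd.marginal_alice ht (T := insert j T) (by omega) (by omega) (by omega) rfl
    (by rw [card_insert_of_notMem hj]; omega) h1' h2' h3'
  rw [sum_ite_eq_add_of_insert (a := fun k => decide (k ∈ T))
    (b := fun k => decide (k ∈ insert j T)) (x := j) _ (by simpa using hj) (by simp)
    (fun k hk => .inl (by simp [hk]))] at e2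
  have ha : intervalInd (p.1.1 + 1) (p.1.2 - p.1.1 - 1) p.1.1 = false := by
    simp only [intervalInd, decide_eq_false_iff_not]; omega
  have hb : intervalInd p.1.1 (p.1.2 - p.1.1) p.1.1 = true := by
    simp only [intervalInd, decide_eq_true_eq]; omega
  have hab : ∀ i : Fin (t + 2 * r), i ≠ p.1.1 → intervalInd p.1.1 (p.1.2 - p.1.1) i =
      intervalInd (p.1.1 + 1) (p.1.2 - p.1.1 - 1) i := fun i hi => by
    simp only [intervalInd, decide_eq_decide]; omega
  rw [sum_ite_eq_add_of_insert (x := p)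
    (a := fun p' : OrdPair (t + 2 * r) => if p'.1.2 = p.1.2 then
      !intervalInd p.1.1 (p.1.2 - p.1.1) p'.1.1 else intervalInd p.1.1 (p.1.2 - p.1.1) p'.1.2)
    (b := fun p' : OrdPair (t + 2 * r) => if p'.1.2 = p.1.2 then
      !intervalInd (p.1.1 + 1) (p.1.2 - p.1.1 - 1) p'.1.1
      else intervalInd (p.1.1 + 1) (p.1.2 - p.1.1 - 1) p'.1.2)
    (fun p' => d (.ab (.inl p.1.2) (.inr p'))) (by simp [hb]) (by simp [ha]) ?_] at e1
  · linarith
  · intro p' hp'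
    by_cases h2 : p'.1.2 = p.1.2
    · left
      rw [if_pos h2, if_pos h2, hab]
      exact fun h => hp' (Subtype.ext (Prod.ext h h2))
    · by_cases h1 : p.1.2 = p'.1.1
      · left
        have h' : p'.1.1.val < p'.1.2.val := p'.2
        rw [if_neg h2, if_neg h2, hab]
        rw [Ne, Fin.ext_iff]
        rw [Fin.ext_iff] at h1
        omega
      · right
        exact hd.bob_primed_eq_zero ht p' _ (.inr ⟨h1, fun h => h2 h.symm⟩)

theorem sub_smul {d' : BellCoord (AliceObs (t + 2 * r) t) (BobObs (t + 2 * r) t) → ℝ}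
    (hd : VanishesOnRoots d) (c : ℝ)
    (h : ∀ e, d' e = d e - c * pureCliqueWebBell (t + 2 * r) t r e) :
    VanishesOnRoots d' := by
  intro f g hfg
  have : linForm d' (classicalPoint f g) = linForm d (classicalPoint f g) -
      c * linForm (pureCliqueWebBell (t + 2 * r) t r) (classicalPoint f g) := by
    simp only [linForm, h, sub_mul, sum_sub_distrib, mul_sum, mul_assoc]
  rw [this, hd f g hfg, hfg, mul_zero, sub_zero]

/-- A linear form without joint terms that vanishes on all roots is zero. -/
theorem eq_zero_of_ab (hd : VanishesOnRoots d) (ht : 2 ≤ t) (h : ∀ P Q, d (.ab P Q) = 0) :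
    d = 0 := by
  have key : ∀ (u m : ℕ) (T : Finset (Fin t)), u + m ≤ t + 2 * r → m ≤ t + r + 1 →
      (m ≤ r + 1 ∧ #T = 0 ∨ m = r + #T ∨ m = r + 1 + #T) →
      ∑ i : Fin (t + 2 * r), (if intervalInd u m i then d (.a (.inl i)) else 0) +
      ∑ j ∈ T, d (.b (.inl j)) = 0 := by
    intro u m T hum hm hT
    have := hd _ _ <| linForm_pureCliqueWebBell_classicalPoint_eq_zero (u := u) (m := m) (T := T)
      (Sum.elim (fun i : Fin (t + 2 * r) => intervalInd u m i) fun q => decide (q.1.2 ∈ T))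
      (Sum.elim (fun k => decide (k ∈ T)) fun p => intervalInd u m p.1.2) (by omega)
      hum hm hT (fun i => rfl) (fun j => rfl) (fun p _ _ => rfl) (fun q _ => rfl)
    rw [linForm_classicalPoint] at this
    rw [Fintype.sum_sum_type, Fintype.sum_sum_type] at this
    simp only [Sum.elim_inl, Sum.elim_inr, h, hd.alice_primed (show 0 < t by omega),
      hd.bob_primed (show 0 < t by omega), ite_self, sum_const_zero, add_zero,
      decide_eq_true_eq, sum_ite_mem, univ_inter] at this
    exact this
  have hA : ∀ i, d (.a (.inl i)) = 0 := fun i => by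
    have hI : ∀ k : Fin (t + 2 * r), intervalInd i 1 k = decide (k = i) := fun k => by
      simp only [intervalInd, decide_eq_decide, Fin.ext_iff]; omega
    simpa [hI] using key i 1 ∅ (by omega) (by omega) (by simp)
  have hB : ∀ j, d (.b (.inl j)) = 0 := fun j => by
    simpa [hA] using key 0 (r + 1) {j} (by omega) (by omega) (by simp)
  funext e
  rcases e with (i | q) | (j | p) | ⟨P, Q⟩
  · exact hA i
  · exact hd.alice_primed (by omega) q
  · exact hB j
  · exact hd.bob_primed (by omega) p
  · exact h P Q

/-- The only linear forms that vanish on the face are the multiples of `pureCliqueWebBell`. -/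
theorem exists_eq_smul (hd : VanishesOnRoots d) (ht : 2 ≤ t) :
    ∃ c : ℝ, d = c • pureCliqueWebBell (t + 2 * r) t r := by
  have hex : ∀ j k : Fin t, j ≠ k → ∃ q : OrdPair t,
      j = q.1.1 ∧ k = q.1.2 ∨ j = q.1.2 ∧ k = q.1.1 := fun j k hjk => by
    rcases lt_or_gt_of_ne hjk with h | h
    · exact ⟨⟨(j, k), h⟩, .inl ⟨rfl, rfl⟩⟩
    · exact ⟨⟨(k, j), h⟩, .inr ⟨rfl, rfl⟩⟩
  have hne : ∀ x x' (j k : Fin t), j ≠ k →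
      d (.ab (.inl x) (.inl j)) = d (.ab (.inl x') (.inl k)) := fun x x' j k hjk => by
    obtain ⟨q, hq⟩ := hex j k hjk
    rw [hd.ab_eq_alice_primed ht q hq, hd.ab_eq_alice_primed ht q (j := k) (k := j) (by tauto)]
  have : Nontrivial (Fin t) := Fin.nontrivial_iff_two_le.2 ht
  have hall : ∀ x x' (j k : Fin t), d (.ab (.inl x) (.inl j)) = d (.ab (.inl x') (.inl k)) :=
    fun x x' j k => by
      by_cases hjk : j = k
      -- A second index `l`, available since `2 ≤ t`, bridges the case `j = k`.
      · obtain ⟨l, hl⟩ := exists_ne j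
        rw [hne x x j l hl.symm, hne x x' l k (hjk ▸ hl)]
      · exact hne x x' j k hjk
  let x₀ : Fin (t + 2 * r) := ⟨0, by omega⟩
  let j₀ : Fin t := ⟨0, by omega⟩
  refine ⟨d (.ab (.inl x₀) (.inl j₀)), ?_⟩
  have hz := (hd.sub_smul (d' := d - d (.ab (.inl x₀) (.inl j₀)) •
    pureCliqueWebBell (t + 2 * r) t r) (d (.ab (.inl x₀) (.inl j₀))) fun e => rfl).eq_zero_of_ab ht ?_
  · exact sub_eq_zero.1 hz
  have hq : ∀ q : OrdPair t, d (.ab (.inr q) (.inl q.1.2)) = d (.ab (.inl x₀) (.inl j₀)) :=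
    fun q => by rw [← hd.ab_eq_alice_primed ht q (.inl ⟨rfl, rfl⟩) x₀]; exact hall _ _ _ _
  have hp : ∀ p : OrdPair (t + 2 * r), webInd r p ≠ 0 →
      d (.ab (.inl p.1.2) (.inr p)) = d (.ab (.inl x₀) (.inl j₀)) := fun p hw => by
    obtain ⟨j, hj⟩ := hd.ab_eq_bob_primed (by omega) p hw
    rw [← hj]; exact hall _ _ _ _
  rintro (i | q) (j | p)
  · simp [pureCliqueWebBell, hall i x₀ j j₀]
  · by_cases hw : webInd r p = 0
    · have hw' : ¬(r + 1 ≤ p.1.2.val - p.1.1.val ∧ p.1.2.val - p.1.1.val ≤ t + 2 * r - r) :=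
        fun h => one_ne_zero ((if_pos h).symm.trans hw)
      simp only [Pi.sub_apply, Pi.smul_apply, pureCliqueWebBell]
      rw [if_neg hw', hd.bob_primed_eq_zero (by omega) p i (.inl hw)]
      simp
    · have hw' : r + 1 ≤ p.1.2.val - p.1.1.val ∧ p.1.2.val - p.1.1.val ≤ t + 2 * r - r := by
        by_contra h
        exact hw (if_neg h)
      simp only [Pi.sub_apply, Pi.smul_apply, pureCliqueWebBell]
      rw [if_pos hw']
      split_ifs with h1 h2
      · rw [h1, hd.bob_primed_fst (by omega), hp p hw]; simp
      · rw [h2, hp p hw]; simp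
      · rw [hd.bob_primed_eq_zero (by omega) p i (.inr ⟨h1, h2⟩)]; simp
  · simp only [Pi.sub_apply, Pi.smul_apply, pureCliqueWebBell]
    split_ifs with h1 h2
    · rw [h1, hd.alice_primed_fst ht, hq q]; simp
    · rw [h2, hq q]; simp
    · rw [hd.alice_primed_eq_zero ht q j ⟨h1, h2⟩]; simp
  · simp [pureCliqueWebBell, hd.primed_primed (show 0 < t by omega)]

end VanishesOnRoots

end Facet

/-! ### From uniqueness of the form to tightness -/

theorem finrank_add_one_of_forall_eq_smul {V : Type} [AddCommGroup V] [Module ℝ V]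
    [FiniteDimensional ℝ V] (W : Submodule ℝ V) (φ : Module.Dual ℝ V) (hφ : φ ≠ 0)
    (hW : W ≤ LinearMap.ker φ)
    (h : ∀ ψ : Module.Dual ℝ V, W ≤ LinearMap.ker ψ → ∃ c : ℝ, ψ = c • φ) :
    Module.finrank ℝ W + 1 = Module.finrank ℝ V := by
  have : W.dualAnnihilator = Submodule.span ℝ {φ} := by
    ext ψ
    rw [Submodule.mem_dualAnnihilator, Submodule.mem_span_singleton]
    constructor
    · intro hψ
      obtain ⟨c, hc⟩ := h ψ hψ
      exact ⟨c, hc.symm⟩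
    · rintro ⟨c, rfl⟩ w hw
      have : φ w = 0 := hW hw
      simp [this]
  rw [← Subspace.finrank_add_finrank_dualAnnihilator_eq W, this, finrank_span_singleton hφ]

/-- A Bell inequality `cᵀ q ≤ 0` that is strict somewhere and an equality at the all-`false`
configuration is tight if every linear form that vanishes on its classical roots is a multiple
of `c`. -/
theorem isTightBellInequality_of_forall_eq_smul {α β : Type} [Fintype α] [Fintype β]
    (c : BellCoord α β → ℝ) (hle : ∀ f g, linForm c (classicalPoint f g) ≤ 0)
    (hlt : ∃ f g, linForm c (classicalPoint f g) ≠ 0)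
    (h : ∀ d : BellCoord α β → ℝ, (∀ f g, linForm c (classicalPoint f g) = 0 →
      linForm d (classicalPoint f g) = 0) → ∃ a : ℝ, d = a • c) :
    IsTightBellInequality c 0 := by
  classical
  have hφ : ∀ d x : BellCoord α β → ℝ, Fintype.linearCombination ℝ d x = linForm d x :=
    fun d x => by
      simp [Fintype.linearCombination_apply, linForm, mul_comm]
  have hmem : ∀ f g, classicalPoint f g ∈ correlationPolytope α β := fun f g =>
    subset_convexHull ℝ _ ⟨(f, g), rfl⟩
  have hzero : classicalPoint (fun _ : α => false) (fun _ : β => false) = 0 := by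
    funext e
    rcases e with i | j | ⟨i, j⟩ <;> simp [classicalPoint]
  have h0 : (0 : BellCoord α β → ℝ) ∈ bellFace c 0 := ⟨hzero ▸ hmem _ _, by simp [linForm]⟩
  have hdual : ∀ ψ : Module.Dual ℝ (BellCoord α β → ℝ),
      vectorSpan ℝ (bellFace c 0) ≤ LinearMap.ker ψ →
      ∃ a : ℝ, ψ = a • Fintype.linearCombination ℝ c := by
    intro ψ hψ
    have hψd : ∀ x, ψ x = linForm (fun e => ψ (Pi.single e 1)) x := fun x => by
      rw [LinearMap.pi_apply_eq_sum_univ ψ x]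
      refine sum_congr rfl fun e _ => ?_
      rw [smul_eq_mul, mul_comm]
      congr 2
      funext k
      simp [Pi.single_apply, eq_comm]
    obtain ⟨a, ha⟩ := h (fun e => ψ (Pi.single e 1)) fun f g hfg => by
      rw [← hψd]
      have := hψ (vsub_mem_vectorSpan ℝ (show classicalPoint f g ∈ bellFace c 0 from
        ⟨hmem f g, hfg⟩) h0)
      simpa using this
    refine ⟨a, LinearMap.ext fun x => ?_⟩
    rw [hψd, ha, LinearMap.smul_apply, hφ]
    simp only [linForm, smul_eq_mul, Pi.smul_apply, mul_sum, mul_assoc]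
  obtain ⟨f₁, g₁, h₁⟩ := hlt
  refine ⟨fun q hq => ?_, ⟨0, h0⟩, ?_⟩
  · have hconv : Convex ℝ {q | Fintype.linearCombination ℝ c q ≤ 0} :=
      convex_halfSpace_le (LinearMap.isLinear _) 0
    have hsub : Set.range (fun p : (α → Bool) × (β → Bool) => classicalPoint p.1 p.2) ⊆
        {q | Fintype.linearCombination ℝ c q ≤ 0} := by
      rintro _ ⟨p, rfl⟩
      exact (hφ c _).trans_le (hle p.1 p.2)
    exact (hφ c q).symm.trans_le (convexHull_min hsub hconv hq)
  -- A functional that kills the directions of the polytope kills those of the face, so it is a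
  -- multiple of `c`; the vertex where `c` is nonzero makes the multiple zero.
  · have htop : vectorSpan ℝ (correlationPolytope α β) = ⊤ := by
      by_contra hne
      obtain ⟨ψ, hψ0, hψ⟩ := Submodule.exists_le_ker_of_lt_top _ (lt_top_iff_ne_top.2 hne)
      obtain ⟨a, rfl⟩ := hdual ψ ((vectorSpan_mono ℝ fun q hq => hq.1).trans hψ)
      have := hψ (vsub_mem_vectorSpan ℝ (hmem f₁ g₁) h0.1)
      rw [LinearMap.mem_ker, vsub_eq_sub, sub_zero, LinearMap.smul_apply, hφ, smul_eq_mul,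
        mul_eq_zero] at this
      exact hψ0 (by rw [this.resolve_right h₁, zero_smul])
    unfold affineDim
    rw [htop, finrank_top]
    refine finrank_add_one_of_forall_eq_smul _ (Fintype.linearCombination ℝ c) ?_ ?_ hdual
    · intro hc
      exact h₁ (by rw [← hφ, hc]; rfl)
    · refine Submodule.span_le.2 ?_
      rintro _ ⟨x, hx, y, hy, rfl⟩
      have hx' := hx.2
      have hy' := hy.2
      rw [← hφ] at hx' hy'
      simp [hx', hy']

theorem linForm_pureCliqueWebBell_single_ne_zero {s t r : ℕ} (j : Fin t) :
    linForm (pureCliqueWebBell s t r) (classicalPoint (fun _ => false)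
      (Sum.elim (fun k => decide (k = j)) fun _ => false)) ≠ 0 := by
  rw [linForm_pureCliqueWebBell]
  have : (0 : ℝ) < j.val + 1 + r := by positivity
  simp [classicalPoint]
  linarith

/-- For `s ≥ t ≥ 2` with `s - t = 2 r`, the Bell inequality `pureCliqueWebBell s t r` is (up to the
factor `2`) the one that corresponds to the triangular elimination of the pure clique-web
inequality with parameters `n = s + t + 1`, `p = s + 1`, `q = t`, `r`, and it is tight. -/
theorem theorem3p2 (s t r : ℕ) (hts : t ≤ s) (ht : 2 ≤ t) (hr : s - t = 2 * r) :
    (∀ q : BellCoord (AliceObs s t) (BobObs s t) → ℝ,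
      linForm (triangularElimination (labelledCliqueWeb s t r)) (cutOfCorr q) =
        2 * linForm (pureCliqueWebBell s t r) q) ∧
    IsTightBellInequality (pureCliqueWebBell s t r) 0 := by
  obtain rfl : s = t + 2 * r := by omega
  refine ⟨linForm_triangularElimination_cutOfCorr t r (by omega),
    isTightBellInequality_of_forall_eq_smul _
      (fun f g => linForm_pureCliqueWebBell_classicalPoint_nonpos f g (by omega))
      ⟨_, _, linForm_pureCliqueWebBell_single_ne_zero ⟨0, by omega⟩⟩
      fun d hd => VanishesOnRoots.exists_eq_smul (d := d) hd ht⟩
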